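/- Fix $\alpha\in[0,1]$. Write $E=L^2(\mathbb R)\cap L^\infty(\mathbb R)$ with $\|f\|_E=\|f\|_{L^2}+\|f\|_{L^\infty}$, and for $\Theta=(y,U,y_\xi,U_\xi,\bar h,h,r)$, functions of $\xi\in\mathbb R$, put $\zeta=y-\mathrm{id}$, $X=(\zeta,U,\zeta_\xi,U_\xi,h,r)$ and $\|X\|_{\bar V}=\|\zeta\|_{L^\infty}+\|U\|_E+\|\zeta_\xi\|_E+\|U_\xi\|_E+\|h\|_E+\|r\|_E$. Let $\mathcal G$ be the set of all $\Theta$ (where $y_\xi,U_\xi$ are the derivatives of $y,U$, and $y,U$ are the continuous representatives) such that $\|X\|_{\bar V}<\infty$, $g(\Theta)-1\in E$, $h\in L^1(\mathbb R)$, $\lim_{\xi\to-\infty}\zeta(\xi)=0$, $\frac1{y_\xi+h}\in L^\infty(\mathbb R)$, and almost everywhere $y_\xi\ge0$, $h\ge\bar h\ge0$, $y_\xi\bar h=U_\xi^2+r^2$. Here $g(\Theta)=\alpha(|U_\xi|+2y_\xi)+(1-\alpha)(y_\xi+\bar h)$ where $|U_\xi|+2y_\xi\le y_\xi+\bar h$,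 $U_\xi\le0$ and $r=0$, and $g(\Theta)=y_\xi+\bar h$ elsewhere. Let $B_M$ be the set of $\Theta$ with $\|X\|_{\bar V}+\|h\|_{L^1}+\|\frac1{y_\xi+h}\|_{L^\infty}\le M$. For $\Theta$ depending on time $t\ge0$ set $\tau_0(\xi)=0$ and, for $n\ge1$, $$\tau_n(\xi)=\sup\{t>\tau_{n-1}(\xi)\mid y_\xi(t',\xi)>0\text{ for all }\tau_{n-1}(\xi)<t'<t\}$$ if there is a $t>\tau_{n-1}(\xi)$ with $y_\xi(t',\xi)>0$ for all $t'\in(\tau_{n-1}(\xi),t)$ and $y_\xi(t,\xi)=0$; otherwise $\tau_n(\xi)=\infty$. The times $\tau_n(\xi)$, $n\ge1$, are the wave-breaking times of $\xi$. A global $\alpha$-dissipative solution with initial data $\Theta_0$ is a map $\Theta\colon[0,\infty)\to\mathcal G$ with $\Theta(0)=\Theta_0$ such that $X$ is continuous in time in the norm of $\bar V$, all $\tau_n$ are measurable, and for almost every $\xi\in\mathbb R$ the following system holds: on every interval $[\tau_{n-1}(\xi),\tau_n(\xi))$, $n\ge1$, in the integrated (Carathéodory) sense, $$y_t=U,\quad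 U_t=-Q,\quad y_{\xi,t}=U_\xi,\quad U_{\xi,t}=\tfrac12\bar h+(U^2-P)y_\xi,\quad h_t=\bar h_t=2(U^2-P)U_\xi,\quad r_t=0,$$ and at every finite $\tau_n(\xi)$, $n\ge1$, the functions $y,U,y_\xi,U_\xi,h,r$ are continuous from the left in time while $\bar h(\tau_n(\xi),\xi)=(1-\alpha)\lim_{t\uparrow\tau_n(\xi)}\bar h(t,\xi)$. Here $$P(t,\xi)=\tfrac14\int_{\mathbb R}e^{-|y(t,\xi)-y(t,\eta)|}(2U^2y_\xi+\bar h)(t,\eta)\,d\eta,$$ $$Q(t,\xi)=-\tfrac14\int_{\mathbb R}\operatorname{sgn}(\xi-\eta)e^{-|y(t,\xi)-y(t,\eta)|}(2U^2y_\xi+\bar h)(t,\eta)\,d\eta.$$ It is not assumed that $\tau_n(\xi)\to\infty$. **Corollary 2.14.** For every $M$ there exists a time $\hat T>0$, depending only on $M$, such that for every $\alpha\in[0,1]$, every $\Theta_0\in\mathcal G\cap B_M$ and every global $\alpha$-dissipative solution $\Theta$ with $\Theta(0)=\Theta_0$ the following hold for almost every $\xi\in\mathbb R$, namely for every $\xi$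 at which the system above holds and at which $y_\xi\ge0$, $\bar h\ge0$ and $y_\xi\bar h=U_\xi^2+r^2$ at $t=0$: 1. the sequence $\tau_j(\xi)$ does not accumulate, i.e. $\tau_j(\xi)\to\infty$ as $j\to\infty$ (possibly $\tau_j(\xi)=\infty$ from some $j$ on); 2. for every $T_0\ge0$ there is at most one $j\ge1$ with $\tau_j(\xi)\in[T_0,T_0+\hat T]$; 3. $\tau_{j+1}(\xi)-\tau_j(\xi)>\hat T$ for all $j\ge1$ with $\tau_j(\xi)<\infty$; 4. $U_\xi(t,\xi)\ge0$ for all $t\in[\tau_j(\xi),\tau_j(\xi)+\hat T]$ and all $j\ge1$ with $\tau_j(\xi)<\infty$. -/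

import Mathlib

open MeasureTheory Filter Set Topology
open scoped ENNReal

noncomputable section

namespace TwoCH

/-- A state in Lagrangian coordinates at a fixed time: the seven functions
`(y, U, y_ξ, U_ξ, h̄, h, r)` of the label `ξ`. The characteristic `y` and the velocity `U` are
the continuous representatives; that `yξ` and `Uξ` are their derivatives is a condition
in `MemG`. -/
structure LagState where
  y : ℝ → ℝ
  U : ℝ → ℝ
  yξ : ℝ → ℝ
  Uξ : ℝ → ℝ
  hbar : ℝ → ℝ
  h : ℝ → ℝ
  r : ℝ → ℝ

/-- The norm of `E = L²(ℝ) ∩ L^∞(ℝ)`, with value `∞` allowed. -/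
def normE (f : ℝ → ℝ) : ℝ≥0∞ := eLpNorm f 2 volume + eLpNorm f ∞ volume

/-- Membership in `E = L²(ℝ) ∩ L^∞(ℝ)`. -/
def MemE (f : ℝ → ℝ) : Prop := MemLp f 2 volume ∧ MemLp f ∞ volume

/-- The norm of `V̄ = L^∞ × E × E⁴` of a six-tuple `(ζ, U, ζ_ξ, U_ξ, h, r)`. -/
def normV (ζ U v w h r : ℝ → ℝ) : ℝ≥0∞ :=
  eLpNorm ζ ∞ volume + normE U + normE v + normE w + normE h + normE r

/-- The norm in `V̄` of the part `X = (ζ, U, ζ_ξ, U_ξ, h, r)` of a state, where `ζ = y - id`. -/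
def LagState.normX (Θ : LagState) : ℝ≥0∞ :=
  normV (fun ξ => Θ.y ξ - ξ) Θ.U (fun ξ => Θ.yξ ξ - 1) Θ.Uξ Θ.h Θ.r

/-- The distance in `V̄` of the `X`-parts of two states. -/
def LagState.distX (Θ Θ' : LagState) : ℝ≥0∞ :=
  normV (fun ξ => Θ.y ξ - Θ'.y ξ) (fun ξ => Θ.U ξ - Θ'.U ξ) (fun ξ => Θ.yξ ξ - Θ'.yξ ξ)
    (fun ξ => Θ.Uξ ξ - Θ'.Uξ ξ) (fun ξ => Θ.h ξ - Θ'.h ξ) (fun ξ => Θ.r ξ - Θ'.r ξ)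

/-- `‖1 / (y_ξ + h)‖_{L^∞}`, with the convention `1 / 0 = ∞`. -/
def LagState.normInv (Θ : LagState) : ℝ≥0∞ :=
  essSup (fun ξ => (ENNReal.ofReal (Θ.yξ ξ + Θ.h ξ))⁻¹) volume

/-- The set `Ω₁`, in terms of `x₃ = y_ξ`, `x₄ = U_ξ`, `x₅ = h̄`, `x₇ = r`. -/
def Omega1 (x₃ x₄ x₅ x₇ : ℝ) : Prop :=
  |x₄| + 2 * x₃ ≤ x₃ + x₅ ∧ x₄ ≤ 0 ∧ x₇ = 0

open Classical in
/-- The function `g`: `α (|x₄| + 2 x₃) + (1 - α) (x₃ + x₅)` on `Ω₁`, and `x₃ + x₅` elsewhere. -/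
def gFun (α x₃ x₄ x₅ x₇ : ℝ) : ℝ :=
  if Omega1 x₃ x₄ x₅ x₇ then α * (|x₄| + 2 * x₃) + (1 - α) * (x₃ + x₅) else x₃ + x₅

/-- The set `𝒢` of admissible Lagrangian states. -/
structure MemG (α : ℝ) (Θ : LagState) : Prop where
  deriv_y : ∀ a b : ℝ, Θ.y b - Θ.y a = ∫ ξ in a..b, Θ.yξ ξ
  deriv_U : ∀ a b : ℝ, Θ.U b - Θ.U a = ∫ ξ in a..b, Θ.Uξ ξ
  memLp_zeta : MemLp (fun ξ => Θ.y ξ - ξ) ∞ volume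
  memE_U : MemE Θ.U
  memE_zeta_xi : MemE (fun ξ => Θ.yξ ξ - 1)
  memE_Uξ : MemE Θ.Uξ
  memE_h : MemE Θ.h
  memE_r : MemE Θ.r
  meas_hbar : AEStronglyMeasurable Θ.hbar volume
  memE_g : MemE (fun ξ => gFun α (Θ.yξ ξ) (Θ.Uξ ξ) (Θ.hbar ξ) (Θ.r ξ) - 1)
  integrable_h : Integrable Θ.h volume
  nonneg : ∀ᵐ ξ, 0 ≤ Θ.yξ ξ ∧ 0 ≤ Θ.h ξ ∧ 0 ≤ Θ.hbar ξ
  lim_zeta : Tendsto (fun ξ => Θ.y ξ - ξ) atBot (𝓝 0)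
  normInv_lt_top : Θ.normInv < ∞
  energy_rel : ∀ᵐ ξ, Θ.yξ ξ * Θ.hbar ξ = Θ.Uξ ξ ^ 2 + Θ.r ξ ^ 2
  hbar_le_h : ∀ᵐ ξ, Θ.hbar ξ ≤ Θ.h ξ

/-- The set `B_M`: `‖X‖_{V̄} + ‖h‖_{L¹} + ‖1 / (y_ξ + h)‖_{L^∞} ≤ M`. -/
def MemB (M : ℝ) (Θ : LagState) : Prop :=
  Θ.normX + eLpNorm Θ.h 1 volume + Θ.normInv ≤ ENNReal.ofReal M

/-- `P(ξ) = ¼ ∫ exp(-|y(ξ) - y(η)|) (2 U² y_ξ + h̄)(η) dη`. -/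
def LagState.P (Θ : LagState) (ξ : ℝ) : ℝ :=
  1 / 4 * ∫ η, Real.exp (-|Θ.y ξ - Θ.y η|) * (2 * Θ.U η ^ 2 * Θ.yξ η + Θ.hbar η)

/-- `Q(ξ) = -¼ ∫ sgn(ξ - η) exp(-|y(ξ) - y(η)|) (2 U² y_ξ + h̄)(η) dη`. -/
def LagState.Q (Θ : LagState) (ξ : ℝ) : ℝ :=
  -(1 / 4) * ∫ η, Real.sign (ξ - η) * Real.exp (-|Θ.y ξ - Θ.y η|) *
    (2 * Θ.U η ^ 2 * Θ.yξ η + Θ.hbar η)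

open Classical in
/-- The first zero of `q` after time `s`, following an interval on which `q` is positive:
`sup {t > s | q > 0 on (s, t)}` if there is a `t > s` with `q > 0` on `(s, t)` and `q t = 0`,
and `∞` otherwise. -/
def nextBreak (q : ℝ → ℝ) (s : EReal) : EReal :=
  if ∃ t : ℝ, s < t ∧ (∀ t' : ℝ, s < t' → t' < t → 0 < q t') ∧ q t = 0 then
    sSup (Real.toEReal '' {t : ℝ | s < t ∧ ∀ t' : ℝ, s < t' → t' < t → 0 < q t'})
  else ⊤

/-- The wave-breaking times of a function of time: `τ₀ = 0`, and `τ_{n+1}` is the next breaking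
time after `τ_n`. -/
def breakSeq (q : ℝ → ℝ) : ℕ → EReal
  | 0 => 0
  | n + 1 => nextBreak q (breakSeq q n)

/-- The breaking times `τ_n(ξ)` of the label `ξ`. Only those with `n ≥ 1` are
times of wave breaking; `τ₀(ξ) = 0` by convention. -/
def tau (Θ : ℝ → LagState) (n : ℕ) (ξ : ℝ) : EReal :=
  breakSeq (fun t => (Θ t).yξ ξ) n

/-- `f' = F` on `[s, e)` in the sense of Carathéodory: `f` is the integral of the locally
integrable function `F`. (The nonlocal terms `P` and `Q` may be discontinuous in time when a set of
labels of positive measure breaks at once, so that the derivative need not be classical.) -/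
def SolvesOn (f F : ℝ → ℝ) (s : ℝ) (e : EReal) : Prop :=
  ∀ t : ℝ, s ≤ t → (t : EReal) < e →
    IntervalIntegrable F volume s t ∧ f t = f s + ∫ x in s..t, F x

/-- The `α`-dissipative Lagrangian system at the label `ξ`: the differential equations on every
interval `[τ_n(ξ), τ_{n+1}(ξ))`, continuity of `X` and reduction of `h̄` by the factor `1 - α` at
every finite breaking time. -/
structure SolvesAt (α : ℝ) (Θ : ℝ → LagState) (ξ : ℝ) : Prop where
  eq_y : ∀ (n : ℕ) (s : ℝ), tau Θ n ξ = s →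
    SolvesOn (fun t => (Θ t).y ξ) (fun t => (Θ t).U ξ) s (tau Θ (n + 1) ξ)
  eq_U : ∀ (n : ℕ) (s : ℝ), tau Θ n ξ = s →
    SolvesOn (fun t => (Θ t).U ξ) (fun t => -(Θ t).Q ξ) s (tau Θ (n + 1) ξ)
  eq_yξ : ∀ (n : ℕ) (s : ℝ), tau Θ n ξ = s →
    SolvesOn (fun t => (Θ t).yξ ξ) (fun t => (Θ t).Uξ ξ) s (tau Θ (n + 1) ξ)
  eq_Uξ : ∀ (n : ℕ) (s : ℝ), tau Θ n ξ = s →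
    SolvesOn (fun t => (Θ t).Uξ ξ)
      (fun t => 1 / 2 * (Θ t).hbar ξ + ((Θ t).U ξ ^ 2 - (Θ t).P ξ) * (Θ t).yξ ξ)
      s (tau Θ (n + 1) ξ)
  eq_h : ∀ (n : ℕ) (s : ℝ), tau Θ n ξ = s →
    SolvesOn (fun t => (Θ t).h ξ)
      (fun t => 2 * ((Θ t).U ξ ^ 2 - (Θ t).P ξ) * (Θ t).Uξ ξ) s (tau Θ (n + 1) ξ)
  eq_hbar : ∀ (n : ℕ) (s : ℝ), tau Θ n ξ = s →
    SolvesOn (fun t => (Θ t).hbar ξ)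
      (fun t => 2 * ((Θ t).U ξ ^ 2 - (Θ t).P ξ) * (Θ t).Uξ ξ) s (tau Θ (n + 1) ξ)
  eq_r : ∀ (n : ℕ) (s : ℝ), tau Θ n ξ = s →
    SolvesOn (fun t => (Θ t).r ξ) (fun _ => 0) s (tau Θ (n + 1) ξ)
  jump_X : ∀ (n : ℕ) (s : ℝ), tau Θ (n + 1) ξ = s →
    Tendsto (fun t => (Θ t).y ξ) (𝓝[<] s) (𝓝 ((Θ s).y ξ)) ∧
    Tendsto (fun t => (Θ t).U ξ) (𝓝[<] s) (𝓝 ((Θ s).U ξ)) ∧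
    Tendsto (fun t => (Θ t).yξ ξ) (𝓝[<] s) (𝓝 ((Θ s).yξ ξ)) ∧
    Tendsto (fun t => (Θ t).Uξ ξ) (𝓝[<] s) (𝓝 ((Θ s).Uξ ξ)) ∧
    Tendsto (fun t => (Θ t).h ξ) (𝓝[<] s) (𝓝 ((Θ s).h ξ)) ∧
    Tendsto (fun t => (Θ t).r ξ) (𝓝[<] s) (𝓝 ((Θ s).r ξ))
  jump_hbar : ∀ (n : ℕ) (s : ℝ), tau Θ (n + 1) ξ = s →
    ∃ l : ℝ, Tendsto (fun t => (Θ t).hbar ξ) (𝓝[<] s) (𝓝 l) ∧ (Θ s).hbar ξ = (1 - α) * l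

/-- `Θ ∈ C(ℝ₊, 𝒢)` is a global `α`-dissipative solution in Lagrangian coordinates with initial
data `Θ₀`. Only the values `Θ t` with `t ≥ 0` matter. It is not required that the breaking times
tend to infinity. -/
structure IsGlobalSolution (α : ℝ) (Θ₀ : LagState) (Θ : ℝ → LagState) : Prop where
  initial : Θ 0 = Θ₀
  memG : ∀ t : ℝ, 0 ≤ t → MemG α (Θ t)
  continuous : ∀ t₀ : ℝ, 0 ≤ t₀ →
    Tendsto (fun t => (Θ t).distX (Θ t₀)) (𝓝[Ici 0] t₀) (𝓝 0)
  measurable_tau : ∀ n : ℕ, AEMeasurable (tau Θ n) volume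
  solves : ∀ᵐ ξ, SolvesAt α Θ ξ

/-- The labels at which the system holds pointwise and at which the initial data satisfy the
pointwise relations `y_ξ ≥ 0`, `h̄ ≥ 0` and `y_ξ h̄ = U_ξ² + r²` of the set `𝒢`. -/
def regularLabels (α : ℝ) (Θ : ℝ → LagState) : Set ℝ :=
  {ξ | SolvesAt α Θ ξ ∧ 0 ≤ (Θ 0).yξ ξ ∧ 0 ≤ (Θ 0).hbar ξ ∧
    (Θ 0).yξ ξ * (Θ 0).hbar ξ = (Θ 0).Uξ ξ ^ 2 + (Θ 0).r ξ ^ 2}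

end TwoCH

end

/-! The proof joins a local statement about one label to a global bound on the coefficient of its
equations. At a breaking time `y_ξ` vanishes, and the relation `y_ξ h̄ = U_ξ² + r²`, conserved
between breakings and passed to the left limit, forces `U_ξ = r = 0`. The triple `(y_ξ, U_ξ, h̄)`
thus restarts from `(0, 0, k)` with `k ≥ 0` and solves a linear system whose only coefficient is `U²
- P`. If `|U² - P| ≤ C`, then for a time `1 / (8 (2C + 1))` the term `h̄ / 2` dominates the
derivative of `U_ξ`, so `U_ξ ≥ 0` (`nonneg_of_rest`). Hence `y_ξ` does not decrease and cannot
return to zero after having been positive (`waiting_time`).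

For a constant `C` depending on `M` alone, the energy `∫ (U² y_ξ + h̄)` is used. It controls the
coefficient, `|U² - P| ≤ 2 · energy` (`MemG.abs_sq_sub_P_le`), it is bounded at time zero by the
norm of `X` (`MemG.energy_le`), and it does not increase (`energy_le_initial`): between breakings
its density changes at the rate `(U³ - 2 P U)_ξ`, whose integral over all labels is zero, and a
breaking only removes the part `α` of `h̄`.

Following the density of a label through its breakings requires that these do not accumulate. To
avoid circularity this is proved first, in `tendsto_tau`: on `[0, T]` continuity in time gives some
energy bound, depending on the solution and on `T`, hence some positive waiting time, which is
enough to reach `T` after finitely many breakings. -/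

open MeasureTheory Filter Set Topology
open scoped ENNReal

noncomputable section

namespace TwoCH

/-! ### Calculus of absolutely continuous functions. -/

/-- `f` is absolutely continuous on the interval between `a` and `b`, and `F` is its derivative
almost everywhere there. -/
structure HasACDeriv (f F : ℝ → ℝ) (a b : ℝ) : Prop where
  ac : AbsolutelyContinuousOnInterval f a b
  deriv : ∀ᵐ x, x ∈ uIcc a b → HasDerivAt f (F x) x

namespace HasACDeriv

variable {f F g G : ℝ → ℝ} {a b : ℝ}

theorem congr_deriv {F' : ℝ → ℝ} (hf : HasACDeriv f F a b) (h : ∀ x, F x = F' x) :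
    HasACDeriv f F' a b := by
  rwa [← funext h]

theorem const (c : ℝ) : HasACDeriv (fun _ => c) (fun _ => 0) a b :=
  ⟨(LipschitzWith.const c).lipschitzOnWith.absolutelyContinuousOnInterval,
    ae_of_all _ fun x _ => hasDerivAt_const x c⟩

theorem add (hf : HasACDeriv f F a b) (hg : HasACDeriv g G a b) :
    HasACDeriv (fun x => f x + g x) (fun x => F x + G x) a b := by
  refine ⟨hf.ac.fun_add hg.ac, ?_⟩
  filter_upwards [hf.deriv, hg.deriv] with x h1 h2 hx using (h1 hx).add (h2 hx)

theorem mul (hf : HasACDeriv f F a b) (hg : HasACDeriv g G a b) :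
    HasACDeriv (fun x => f x * g x) (fun x => F x * g x + f x * G x) a b := by
  refine ⟨hf.ac.fun_mul hg.ac, ?_⟩
  filter_upwards [hf.deriv, hg.deriv] with x h1 h2 hx using (h1 hx).mul (h2 hx)

theorem const_mul (c : ℝ) (hf : HasACDeriv f F a b) :
    HasACDeriv (fun x => c * f x) (fun x => c * F x) a b :=
  ((const c).mul hf).congr_deriv fun x => by ring

theorem sub (hf : HasACDeriv f F a b) (hg : HasACDeriv g G a b) :
    HasACDeriv (fun x => f x - g x) (fun x => F x - G x) a b := by
  refine ⟨hf.ac.fun_sub hg.ac, ?_⟩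
  filter_upwards [hf.deriv, hg.deriv] with x h1 h2 hx using (h1 hx).sub (h2 hx)

theorem pow_two (hf : HasACDeriv f F a b) :
    HasACDeriv (fun x => f x ^ 2) (fun x => 2 * f x * F x) a b := by
  simp_rw [sq]
  exact (hf.mul hf).congr_deriv fun x => by ring

theorem deriv_ae_eq (hf : HasACDeriv f F a b) :
    ∀ᵐ x, x ∈ uIoc a b → _root_.deriv f x = F x := by
  filter_upwards [hf.deriv] with x hx h using (hx (uIoc_subset_uIcc h)).deriv

theorem intervalIntegrable (hf : HasACDeriv f F a b) : IntervalIntegrable F volume a b := by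
  refine hf.ac.intervalIntegrable_deriv.congr_ae ?_
  rw [Filter.EventuallyEq, ae_restrict_iff' measurableSet_uIoc]
  exact hf.deriv_ae_eq

theorem integral_eq_sub (hf : HasACDeriv f F a b) : ∫ x in a..b, F x = f b - f a := by
  rw [← hf.ac.integral_deriv_eq_sub]
  refine intervalIntegral.integral_congr_ae ?_
  filter_upwards [hf.deriv_ae_eq] with x hx h using (hx h).symm

/-- A primitive of an interval integrable function has that function as its derivative. -/
theorem of_primitive (hab : a ≤ b) (hF : IntervalIntegrable F volume a b)
    (h : ∀ x ∈ Icc a b, f x = f a + ∫ t in a..x, F t) : HasACDeriv f F a b := by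
  have hP : HasACDeriv (fun x => f a + ∫ t in a..x, F t) F a b := by
    have h1 : HasACDeriv (fun x => ∫ t in a..x, F t) F a b := by
      refine ⟨hF.absolutelyContinuousOnInterval_intervalIntegral (by simp), ?_⟩
      filter_upwards [hF.ae_hasDerivAt_integral] with x hx h using hx h a (by simp)
    exact ((const (f a)).add h1).congr_deriv fun x => by simp
  constructor
  · have h2 := hP.ac
    rw [absolutelyContinuousOnInterval_iff] at h2 ⊢
    intro ε hε
    obtain ⟨δ, hδ, H⟩ := h2 ε hε
    refine ⟨δ, hδ, fun E hE hlt => ?_⟩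
    convert H E hE hlt using 2 with i hi
    have h3 := hE.1 i hi
    rw [uIcc_of_le hab] at h3
    rw [h _ h3.1, h _ h3.2]
  · have h1 : ∀ᵐ x : ℝ, x ≠ a := by simp [ae_iff, measure_singleton]
    have h2 : ∀ᵐ x : ℝ, x ≠ b := by simp [ae_iff, measure_singleton]
    filter_upwards [hP.deriv, h1, h2] with x hx ha hb hm
    refine (hx hm).congr_of_eventuallyEq ?_
    rw [uIcc_of_le hab] at hm
    filter_upwards [Icc_mem_nhds (lt_of_le_of_ne hm.1 (Ne.symm ha)) (lt_of_le_of_ne hm.2 hb)]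
      with y hy using h y hy

end HasACDeriv

/-! ### Decay at infinity. -/

/-- A square integrable primitive of `v`, with `u v` integrable, tends to zero at infinity. -/
theorem tendsto_sq_atTop_zero {u v : ℝ → ℝ} (h : ∀ a b, a ≤ b → HasACDeriv u v a b)
    (hu : Integrable fun x => u x ^ 2) (huv : Integrable fun x => u x * v x) :
    Tendsto (fun x => u x ^ 2) atTop (𝓝 0) := by
  have h1 : ∀ x, 0 ≤ x → u x ^ 2 = u 0 ^ 2 + ∫ t in (0 : ℝ)..x, 2 * (u t * v t) := by
    intro x hx
    have := (h 0 x hx).pow_two.integral_eq_sub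
    simp only [mul_assoc] at this
    rw [this]; ring
  have h2 : Tendsto (fun x => u x ^ 2) atTop
      (𝓝 (u 0 ^ 2 + ∫ t in Ioi (0 : ℝ), 2 * (u t * v t))) := by
    refine Tendsto.congr' ?_ ((intervalIntegral_tendsto_integral_Ioi 0
      (huv.const_mul 2).integrableOn tendsto_id).const_add _)
    filter_upwards [eventually_ge_atTop 0] with x hx using (h1 x hx).symm
  -- The limit exists because `u v` is integrable. It is zero because `u²` is integrable while every
  -- neighbourhood of infinity has infinite measure.
  have h3 := (hu.integrableAtFilter atTop).eq_zero_of_tendsto (fun s hs => by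
    obtain ⟨c, hc⟩ := mem_atTop_sets.1 hs
    exact top_unique ((Real.volume_Ici (a := c)).symm.le.trans (measure_mono fun x hx => hc x hx)))
    h2
  rwa [h3] at h2

theorem tendsto_sq_atBot_zero {u v : ℝ → ℝ} (h : ∀ a b, a ≤ b → HasACDeriv u v a b)
    (hu : Integrable fun x => u x ^ 2) (huv : Integrable fun x => u x * v x) :
    Tendsto (fun x => u x ^ 2) atBot (𝓝 0) := by
  have h1 : ∀ x, x ≤ 0 → u x ^ 2 = u 0 ^ 2 - ∫ t in x..(0 : ℝ), 2 * (u t * v t) := by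
    intro x hx
    have := (h x 0 hx).pow_two.integral_eq_sub
    simp only [mul_assoc] at this
    rw [this]; ring
  have h2 : Tendsto (fun x => u x ^ 2) atBot
      (𝓝 (u 0 ^ 2 - ∫ t in Iic (0 : ℝ), 2 * (u t * v t))) := by
    refine Tendsto.congr' ?_ ((intervalIntegral_tendsto_integral_Iic 0
      (huv.const_mul 2).integrableOn tendsto_id).const_sub _)
    filter_upwards [eventually_le_atBot 0] with x hx using (h1 x hx).symm
  have h3 := (hu.integrableAtFilter atBot).eq_zero_of_tendsto (fun s hs => by
    obtain ⟨c, hc⟩ := mem_atBot_sets.1 hs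
    exact top_unique ((Real.volume_Iic (a := c)).symm.le.trans (measure_mono fun x hx => hc x hx)))
    h2
  rwa [h3] at h2

/-! ### Breaking times as first zeros. -/

theorem lt_of_mem_breakSet {q : ℝ → ℝ} {s : EReal} {t u : ℝ} (ht : s < t) (hq : q t = 0)
    (hu : ∀ t' : ℝ, s < t' → t' < u → 0 < q t') : u ≤ t := by
  by_contra h
  exact (hu t ht (not_le.1 h)).ne' hq

/-- A zero at `t` bounds every competitor in the supremum by `t`, so the supremum is attained there.
-/
theorem nextBreak_eq {q : ℝ → ℝ} {s : EReal} {t : ℝ} (hst : s < t)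
    (hpos : ∀ t' : ℝ, s < t' → t' < t → 0 < q t') (hq : q t = 0) : nextBreak q s = t := by
  rw [nextBreak, if_pos ⟨t, hst, hpos, hq⟩]
  refine le_antisymm (sSup_le ?_) (le_sSup ⟨t, ⟨hst, hpos⟩, rfl⟩)
  rintro _ ⟨u, ⟨_, hu⟩, rfl⟩
  exact EReal.coe_le_coe_iff.2 (lt_of_mem_breakSet hst hq hu)

theorem nextBreak_lt_top {q : ℝ → ℝ} {s : EReal} (h : nextBreak q s < ⊤) :
    ∃ t : ℝ, nextBreak q s = t ∧ s < t ∧ (∀ t' : ℝ, s < t' → t' < t → 0 < q t') ∧ q t = 0 := by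
  by_cases H : ∃ t : ℝ, s < t ∧ (∀ t' : ℝ, s < t' → t' < t → 0 < q t') ∧ q t = 0
  · obtain ⟨t, h1, h2, h3⟩ := H
    exact ⟨t, nextBreak_eq h1 h2 h3, h1, h2, h3⟩
  · rw [nextBreak, if_neg H] at h
    exact absurd h (lt_irrefl _)

theorem le_nextBreak (q : ℝ → ℝ) (s : EReal) : s ≤ nextBreak q s := by
  by_cases h : nextBreak q s < ⊤
  · obtain ⟨t, h1, h2, -⟩ := nextBreak_lt_top h
    rw [h1]
    exact h2.le
  · rw [not_lt_top_iff.1 h]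
    exact le_top

theorem breakSeq_monotone (q : ℝ → ℝ) : Monotone (breakSeq q) :=
  monotone_nat_of_le_succ fun _ => le_nextBreak _ _

theorem breakSeq_nonneg (q : ℝ → ℝ) (n : ℕ) : 0 ≤ breakSeq q n :=
  breakSeq_monotone q n.zero_le

theorem exists_real_of_breakSeq_lt_top {q : ℝ → ℝ} {n : ℕ} (h : breakSeq q n < ⊤) :
    ∃ s : ℝ, 0 ≤ s ∧ breakSeq q n = s := by
  have h0 := breakSeq_nonneg q n
  lift breakSeq q n to ℝ using ⟨h.ne, (lt_of_lt_of_le EReal.bot_lt_zero h0).ne'⟩ with s hs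
  exact ⟨s, EReal.coe_nonneg.1 h0, rfl⟩

/-- A finite breaking time is preceded by a finite time with positivity in between. -/
theorem breakSeq_succ_eq_coe {q : ℝ → ℝ} {n : ℕ} {e : ℝ} (h : breakSeq q (n + 1) = e) :
    ∃ s : ℝ, 0 ≤ s ∧ breakSeq q n = s ∧ s < e ∧ (∀ t, s < t → t < e → 0 < q t) ∧ q e = 0 := by
  have h1 : nextBreak q (breakSeq q n) < ⊤ := by
    change breakSeq q (n + 1) < ⊤
    rw [h]; exact EReal.coe_lt_top e
  obtain ⟨t, h2, h3, h4, h5⟩ := nextBreak_lt_top h1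
  have h6 : e = t := by
    rw [← EReal.coe_eq_coe_iff, ← h, ← h2]; rfl
  subst h6
  obtain ⟨s, hs0, hs⟩ := exists_real_of_breakSeq_lt_top (h3.trans (EReal.coe_lt_top e))
  rw [hs] at h3 h4
  exact ⟨s, hs0, hs, EReal.coe_lt_coe_iff.1 h3, fun t ht hte =>
    h4 t (EReal.coe_lt_coe_iff.2 ht) hte, h5⟩

/-! ### The system at a single label and the waiting time after breaking. -/

theorem SolvesOn.hasACDeriv {f F : ℝ → ℝ} {s t : ℝ} {e : EReal} (h : SolvesOn f F s e)
    (hst : s ≤ t) (hte : (t : EReal) < e) : HasACDeriv f F s t :=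
  .of_primitive hst (h t hst hte).1 fun x hx =>
    (h x hx.1 ((EReal.coe_le_coe_iff.2 hx.2).trans_lt hte)).2

theorem HasACDeriv.sub_eq {f F : ℝ → ℝ} {a b t : ℝ} (h : HasACDeriv f F a b) (ht : t ∈ Icc a b) :
    f t - f a = ∫ x in a..t, F x := by
  have hs : uIcc a t ⊆ uIcc a b :=
    uIcc_subset_uIcc_left (by rw [uIcc_of_le (ht.1.trans ht.2)]; exact ht)
  have h' : HasACDeriv f F a t :=
    ⟨h.ac.mono hs, by filter_upwards [h.deriv] with x hx hm using hx (hs hm)⟩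
  exact h'.integral_eq_sub.symm

theorem HasACDeriv.abs_sub_le {f F : ℝ → ℝ} {a b t K : ℝ} (h : HasACDeriv f F a b)
    (ht : t ∈ Icc a b) (hK : ∀ x ∈ Icc a b, |F x| ≤ K) : |f t - f a| ≤ K * (t - a) := by
  rw [h.sub_eq ht]
  have := intervalIntegral.norm_integral_le_of_norm_le_const (a := a) (b := t) (f := F) (C := K)
    fun x hx => hK x (by rw [uIoc_of_le ht.1] at hx; exact ⟨hx.1.le, hx.2.trans ht.2⟩)
  rwa [abs_of_nonneg (sub_nonneg.2 ht.1)] at this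

/-- Started from `q = w = 0` and `k ≥ 0`, the system `q' = w`, `w' = k / 2 + a q`, `k' = 2 a w` with
`|a| ≤ C` keeps `w` nonnegative for a time depending on `C` only. -/
theorem nonneg_of_rest {q w k a : ℝ → ℝ} {s b C : ℝ} (hsb : s ≤ b)
    (hC : 0 ≤ C) (hb : 8 * (2 * C + 1) * (b - s) ≤ 1) (ha : ∀ t ∈ Icc s b, |a t| ≤ C)
    (hq : HasACDeriv q w s b) (hw : HasACDeriv w (fun t => 1 / 2 * k t + a t * q t) s b)
    (hk : HasACDeriv k (fun t => 2 * a t * w t) s b)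
    (hq0 : q s = 0) (hw0 : w s = 0) (hk0 : 0 ≤ k s) : ∀ t ∈ Icc s b, 0 ≤ w t := by
  have cq := hq.ac.continuousOn
  have cw := hw.ac.continuousOn
  have ck := hk.ac.continuousOn
  rw [uIcc_of_le hsb] at cq cw ck
  -- All estimates are made relative to `m`, the largest value of `|q|`, `|w|`, `|k|` on `[s, b]`;
  -- all three derivatives are at most `(2C + 1) m`, so on this short interval each function moves
  -- by at most `m / 8`.
  obtain ⟨t₀, ht₀, hmax⟩ := isCompact_Icc.exists_isMaxOn (nonempty_Icc.2 hsb)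
    ((cq.abs.sup cw.abs).sup ck.abs)
  obtain ⟨m, hm⟩ : ∃ m, m = |q t₀| ⊔ |w t₀| ⊔ |k t₀| := ⟨_, rfl⟩
  have hle : ∀ t ∈ Icc s b, |q t| ≤ m ∧ |w t| ≤ m ∧ |k t| ≤ m := by
    intro t ht
    have := hmax ht
    simp only [mem_ofPred_eq, ← hm] at this
    exact ⟨(le_sup_left.trans le_sup_left).trans this, (le_sup_right.trans le_sup_left).trans this,
      le_sup_right.trans this⟩
  have hm0 : 0 ≤ m := (abs_nonneg _).trans (hle t₀ ht₀).1
  have hCm : 0 ≤ C * m := mul_nonneg hC hm0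
  have bound : ∀ t ∈ Icc s b, ∀ x y z : ℝ, x ≤ y * (t - s) → y ≤ z → 0 ≤ z → x ≤ z * (b - s) := by
    intro t ht x y z h1 h2 h3
    have := mul_le_mul_of_nonneg_right h2 (sub_nonneg.2 ht.1)
    have := mul_le_mul_of_nonneg_left (sub_le_sub_right ht.2 s) h3
    linarith
  have hd : (2 * C + 1) * m * (b - s) ≤ m / 8 := by nlinarith
  have hd' : C * m * (b - s) ≤ m / 16 := by nlinarith [mul_nonneg hm0 (sub_nonneg.2 hsb)]
  have eq : ∀ t ∈ Icc s b, |q t| ≤ m / 8 ∧ |q t| ≤ m * (b - s) := by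
    intro t ht
    have h1 := hq.abs_sub_le ht fun x hx => (hle x hx).2.1
    rw [hq0, sub_zero] at h1
    exact ⟨(bound t ht _ _ _ h1 (by linarith : m ≤ (2 * C + 1) * m) (by linarith)).trans hd,
      bound t ht _ _ _ h1 le_rfl hm0⟩
  have ew : ∀ t ∈ Icc s b, |w t| ≤ m / 8 := by
    intro t ht
    have h1 := hw.abs_sub_le (K := (2 * C + 1) * m) ht fun x hx => by
      have h2 := hle x hx
      have h3 : |a x * q x| ≤ C * m := by
        rw [abs_mul]; exact mul_le_mul (ha x hx) h2.1 (abs_nonneg _) hC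
      have h4 := abs_add_le (1 / 2 * k x) (a x * q x)
      rw [abs_mul, abs_of_pos (by norm_num : (0 : ℝ) < 1 / 2)] at h4
      linarith [h2.2.2]
    rw [hw0, sub_zero] at h1
    exact (bound t ht _ _ _ h1 le_rfl (by linarith)).trans hd
  have ek : ∀ t ∈ Icc s b, |k t - k s| ≤ m / 8 := by
    intro t ht
    have h1 := hk.abs_sub_le (K := (2 * C + 1) * m) ht fun x hx => by
      have h3 : |a x * w x| ≤ C * m := by
        rw [abs_mul]; exact mul_le_mul (ha x hx) (hle x hx).2.1 (abs_nonneg _) hC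
      rw [mul_assoc, abs_mul, abs_of_pos (by norm_num : (0 : ℝ) < 2)]
      linarith
    exact (bound t ht _ _ _ h1 le_rfl (by linarith)).trans hd
  -- Since `q` and `w` start from zero, the maximum `m` must essentially come from `k`: this gives
  -- `k s ≥ 7m/8`, hence `k ≥ 3m/4` throughout.
  have hmk : m ≤ k s + m / 8 := by
    have h1 : |k t₀| ≤ k s + m / 8 := by
      have h2 := abs_le.1 (ek t₀ ht₀)
      rw [abs_le]; constructor <;> linarith
    have h3 : m ≤ k s + m / 8 := by
      conv_lhs => rw [hm]
      exact sup_le (sup_le (by linarith [(eq t₀ ht₀).1]) (by linarith [ew t₀ ht₀])) h1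
    exact h3
  intro t ht
  have h1 := hw.sub_eq ht
  rw [hw0, sub_zero] at h1
  rw [h1]
  -- The integrand is at least `3m/8 - m/16`.
  refine intervalIntegral.integral_nonneg ht.1 fun x hx => ?_
  have hx' : x ∈ Icc s b := ⟨hx.1, hx.2.trans ht.2⟩
  have h3 : |a x * q x| ≤ C * (m * (b - s)) := by
    rw [abs_mul]; exact mul_le_mul (ha x hx') (eq x hx').2 (abs_nonneg _) hC
  have h4 := (abs_le.1 h3).1
  have h5 := (abs_le.1 (ek x hx')).1
  nlinarith

section

variable {α : ℝ} {Θ : ℝ → LagState} {ξ : ℝ}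

/-- The time derivative of `y_ξ h̄ - U_ξ² - r²` cancels identically. -/
theorem SolvesAt.energy_rel (h : SolvesAt α Θ ξ) {n : ℕ} {s t : ℝ} (hs : tau Θ n ξ = s)
    (hst : s ≤ t) (hte : (t : EReal) < tau Θ (n + 1) ξ)
    (h0 : (Θ s).yξ ξ * (Θ s).hbar ξ = (Θ s).Uξ ξ ^ 2 + (Θ s).r ξ ^ 2) :
    (Θ t).yξ ξ * (Θ t).hbar ξ = (Θ t).Uξ ξ ^ 2 + (Θ t).r ξ ^ 2 := by
  have hq := (h.eq_yξ n s hs).hasACDeriv hst hte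
  have hw := (h.eq_Uξ n s hs).hasACDeriv hst hte
  have hk := (h.eq_hbar n s hs).hasACDeriv hst hte
  have hr := (h.eq_r n s hs).hasACDeriv hst hte
  have H := (((hq.mul hk).sub hw.pow_two).sub hr.pow_two).congr_deriv (F' := fun _ => 0)
    fun x => by ring
  have := H.integral_eq_sub
  simp only [intervalIntegral.integral_zero] at this
  linarith

theorem lt_tau_succ {n : ℕ} {e t : ℝ} (he : tau Θ (n + 1) ξ = e) (ht : t < e) :
    (t : EReal) < tau Θ (n + 1) ξ := by
  rw [he]; exact EReal.coe_lt_coe_iff.2 ht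

/-- The state of a regular label at the times `τ_n`. -/
theorem regular_at_tau (hα : α ≤ 1) (h : ξ ∈ regularLabels α Θ) (n : ℕ) :
    ∀ s : ℝ, tau Θ n ξ = s → 0 ≤ (Θ s).yξ ξ ∧ 0 ≤ (Θ s).hbar ξ ∧
      (Θ s).yξ ξ * (Θ s).hbar ξ = (Θ s).Uξ ξ ^ 2 + (Θ s).r ξ ^ 2 ∧
      (n ≠ 0 → (Θ s).yξ ξ = 0 ∧ (Θ s).Uξ ξ = 0 ∧ (Θ s).r ξ = 0 ∧
        ∃ l : ℝ, Tendsto (fun t => (Θ t).hbar ξ) (𝓝[<] s) (𝓝 l) ∧ 0 ≤ l ∧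
          (Θ s).hbar ξ = (1 - α) * l) := by
  induction n with
  | zero =>
    intro s hs
    have : s = 0 := by
      rw [← EReal.coe_eq_coe_iff, ← hs]; rfl
    subst this
    exact ⟨h.2.1, h.2.2.1, h.2.2.2, fun h => absurd rfl h⟩
  | succ n ih =>
    intro e he
    obtain ⟨s, -, hs, hse, hpos, hqe⟩ := breakSeq_succ_eq_coe he
    obtain ⟨-, -, hrel, -⟩ := ih s hs
    obtain ⟨-, -, hq, hw, -, hr⟩ := h.1.jump_X n e he
    obtain ⟨l, hl, hjump⟩ := h.1.jump_hbar n e he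
    have hev : ∀ᶠ t in 𝓝[<] e, t ∈ Ioo s e := Ioo_mem_nhdsLT hse
    have hrel' : ∀ᶠ t in 𝓝[<] e,
        (Θ t).yξ ξ * (Θ t).hbar ξ = (Θ t).Uξ ξ ^ 2 + (Θ t).r ξ ^ 2 := by
      filter_upwards [hev] with t ht using h.1.energy_rel hs ht.1.le (lt_tau_succ he ht.2) hrel
    have hl0 : 0 ≤ l := by
      refine ge_of_tendsto hl ?_
      filter_upwards [hev, hrel'] with t ht h1
      have h2 := hpos t ht.1 ht.2
      exact nonneg_of_mul_nonneg_right (h1 ▸ by positivity) h2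
    -- In the left limit the relation reads `0 = U_ξ² + r²`. The jump of `h̄` then does no harm to
    -- it, as `h̄` is multiplied by `y_ξ = 0`.
    have hlim : (Θ e).yξ ξ * l = (Θ e).Uξ ξ ^ 2 + (Θ e).r ξ ^ 2 :=
      tendsto_nhds_unique_of_eventuallyEq (hq.mul hl) ((hw.pow 2).add (hr.pow 2)) hrel'
    rw [hqe, zero_mul] at hlim
    have hw0 : (Θ e).Uξ ξ = 0 := by nlinarith [sq_nonneg ((Θ e).Uξ ξ), sq_nonneg ((Θ e).r ξ)]
    have hr0 : (Θ e).r ξ = 0 := by nlinarith [sq_nonneg ((Θ e).Uξ ξ), sq_nonneg ((Θ e).r ξ)]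
    refine ⟨hqe.ge, ?_, ?_, fun _ => ⟨hqe, hw0, hr0, l, hl, hl0, hjump⟩⟩
    · rw [hjump]; exact mul_nonneg (by linarith) hl0
    · rw [hqe, hw0, hr0]; ring

/-- After a breaking time there is a waiting time during which `U_ξ ≥ 0` and no breaking occurs. -/
theorem waiting_time (hα : α ≤ 1) (h : ξ ∈ regularLabels α Θ) {n : ℕ} (hn : n ≠ 0) {s b C : ℝ}
    (hs : tau Θ n ξ = s) (hC : 0 ≤ C) (hb : 8 * (2 * C + 1) * (b - s) ≤ 1)
    (hbd : ∀ t ∈ Icc s b, |(Θ t).U ξ ^ 2 - (Θ t).P ξ| ≤ C) :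
    (b : EReal) < tau Θ (n + 1) ξ ∧ ∀ t ∈ Icc s b, 0 ≤ (Θ t).Uξ ξ := by
  obtain ⟨-, hk0, -, h1⟩ := regular_at_tau hα h n s hs
  obtain ⟨hq0, hw0, -, -⟩ := h1 hn
  have key : ∀ t, s ≤ t → t ≤ b → (t : EReal) < tau Θ (n + 1) ξ → 0 ≤ (Θ t).Uξ ξ := by
    intro t hst htb hte
    exact nonneg_of_rest (q := fun t => (Θ t).yξ ξ) (w := fun t => (Θ t).Uξ ξ)
      (k := fun t => (Θ t).hbar ξ) (a := fun t => (Θ t).U ξ ^ 2 - (Θ t).P ξ) hst hC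
      (by nlinarith) (fun x hx => hbd x ⟨hx.1, hx.2.trans htb⟩)
      ((h.1.eq_yξ n s hs).hasACDeriv hst hte) ((h.1.eq_Uξ n s hs).hasACDeriv hst hte)
      ((h.1.eq_hbar n s hs).hasACDeriv hst hte) hq0 hw0 hk0 t ⟨hst, le_rfl⟩
  have hlt : (b : EReal) < tau Θ (n + 1) ξ := by
    by_contra hcon
    obtain ⟨e, -, he⟩ := exists_real_of_breakSeq_lt_top
      ((not_lt.1 hcon).trans_lt (EReal.coe_lt_top b))
    have he' : tau Θ (n + 1) ξ = e := he
    have heb : e ≤ b := by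
      rw [not_lt, he'] at hcon; exact EReal.coe_le_coe_iff.1 hcon
    obtain ⟨s', -, hs', hse, hpos, hqe⟩ := breakSeq_succ_eq_coe he
    obtain rfl : s = s' := by
      rw [← EReal.coe_eq_coe_iff, ← hs, ← hs']; rfl
    obtain ⟨t₀, h1, h2⟩ := exists_between hse
    -- Were the next breaking `e` at most `b`, then `U_ξ ≥ 0` would make `y_ξ` nondecreasing up to
    -- `e`, and its left limit there would be at least the positive value at `t₀`.
    have hmono : ∀ᶠ t in 𝓝[<] e, (Θ t₀).yξ ξ ≤ (Θ t).yξ ξ := by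
      filter_upwards [Ioo_mem_nhdsLT h2] with t ht
      have hd := (h.1.eq_yξ n s hs).hasACDeriv (h1.trans ht.1).le (lt_tau_succ he' ht.2)
      have e1 := hd.sub_eq ⟨h1.le, ht.1.le⟩
      have e2 := hd.sub_eq ⟨(h1.trans ht.1).le, le_rfl⟩
      have hi := hd.intervalIntegrable
      have e3 := intervalIntegral.integral_add_adjacent_intervals
        (hi.mono_set (uIcc_subset_uIcc_left (by
          rw [uIcc_of_le (h1.trans ht.1).le]; exact ⟨h1.le, ht.1.le⟩)) :
          IntervalIntegrable _ volume s t₀)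
        (hi.mono_set (uIcc_subset_uIcc_right (by
          rw [uIcc_of_le (h1.trans ht.1).le]; exact ⟨h1.le, ht.1.le⟩)))
      have e4 : 0 ≤ ∫ x in t₀..t, (Θ x).Uξ ξ :=
        intervalIntegral.integral_nonneg ht.1.le fun x hx =>
          key x (h1.le.trans hx.1) ((hx.2.trans ht.2.le).trans heb)
            (lt_tau_succ he' (hx.2.trans_lt ht.2))
      linarith
    have hlim := ge_of_tendsto (h.1.jump_X n e he').2.2.1 hmono
    have := hpos t₀ h1 h2
    change (Θ e).yξ ξ = 0 at hqe
    change 0 < (Θ t₀).yξ ξ at this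
    linarith
  exact ⟨hlt, fun t ht => key t ht.1 ht.2 ((EReal.coe_le_coe_iff.2 ht.2).trans_lt hlt)⟩

end

/-! ### Energy, and the bounds it gives at a fixed time. -/

theorem ae_abs_le_of_memLp_top {f : ℝ → ℝ} (hf : MemLp f ∞ volume) :
    ∀ᵐ x, |f x| ≤ (eLpNorm f ∞ volume).toReal := by
  have h := ae_le_eLpNormEssSup (f := f) (μ := volume)
  filter_upwards [h] with x hx
  rw [← eLpNorm_exponent_top] at hx
  have := ENNReal.toReal_mono hf.2.ne hx
  simpa using this

/-- The energy density `U² y_ξ + h̄`. -/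
def LagState.edens (Θ : LagState) (ξ : ℝ) : ℝ := Θ.U ξ ^ 2 * Θ.yξ ξ + Θ.hbar ξ

/-- The source `2 U² y_ξ + h̄` of the nonlocal terms. -/
def LagState.source (Θ : LagState) (ξ : ℝ) : ℝ := 2 * Θ.U ξ ^ 2 * Θ.yξ ξ + Θ.hbar ξ

/-- The energy. -/
def LagState.energy (Θ : LagState) : ℝ := ∫ ξ, Θ.edens ξ

/-- The kernel of the nonlocal terms. -/
def LagState.ker (Θ : LagState) (ξ η : ℝ) : ℝ := Real.exp (-|Θ.y ξ - Θ.y η|)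

theorem LagState.ker_pos (Θ : LagState) (ξ η : ℝ) : 0 < Θ.ker ξ η := Real.exp_pos _

theorem LagState.ker_le_one (Θ : LagState) (ξ η : ℝ) : Θ.ker ξ η ≤ 1 :=
  Real.exp_le_one_iff.2 (neg_nonpos.2 (abs_nonneg _))

theorem LagState.P_eq (Θ : LagState) (ξ : ℝ) :
    Θ.P ξ = 1 / 4 * ∫ η, Θ.ker ξ η * Θ.source η := rfl

theorem LagState.Q_eq (Θ : LagState) (ξ : ℝ) :
    Θ.Q ξ = -(1 / 4) * ∫ η, Real.sign (ξ - η) * Θ.ker ξ η * Θ.source η := rfl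

/-- Makes the nonlocal kernel Lipschitz in the label, as `y` is. -/
theorem abs_exp_neg_sub_le {u v : ℝ} (hu : 0 ≤ u) (hv : 0 ≤ v) :
    |Real.exp (-u) - Real.exp (-v)| ≤ |u - v| := by
  wlog h : u ≤ v generalizing u v
  · rw [abs_sub_comm, abs_sub_comm u]
    exact this hv hu (le_of_not_ge h)
  have h1 : Real.exp (-v) ≤ Real.exp (-u) := Real.exp_le_exp.2 (by linarith)
  have h2 := Real.add_one_le_exp (-(v - u))
  have h3 : Real.exp (-v) = Real.exp (-u) * Real.exp (-(v - u)) := by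
    rw [← Real.exp_add]; ring_nf
  have h4 : Real.exp (-u) ≤ 1 := Real.exp_le_one_iff.2 (by linarith)
  rw [abs_of_nonneg (by linarith), abs_of_nonpos (by linarith), h3]
  nlinarith [Real.exp_pos (-u)]

theorem abs_sign_le_one (x : ℝ) : |Real.sign x| ≤ 1 := by
  rcases Real.sign_apply_eq x with h | h | h <;> simp [h]

theorem measurable_sign : Measurable Real.sign := by
  unfold Real.sign
  exact Measurable.ite measurableSet_Iio measurable_const
    (Measurable.ite measurableSet_Ioi measurable_const measurable_const)

namespace MemG

variable {α : ℝ} {Θ : LagState}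

theorem aesm_yξ (h : MemG α Θ) : AEStronglyMeasurable Θ.yξ volume := by
  exact (h.memE_zeta_xi.1.1.add (aestronglyMeasurable_const (b := (1 : ℝ)))).congr
    (ae_of_all _ fun x => by simp)

theorem aesm_y (h : MemG α Θ) : AEStronglyMeasurable Θ.y volume := by
  exact (h.memLp_zeta.1.add aestronglyMeasurable_id).congr (ae_of_all _ fun x => by simp)

/-- A bound for `y_ξ`. -/
theorem exists_yξ_le (h : MemG α Θ) : ∃ K : NNReal, ∀ᵐ ξ, Θ.yξ ξ ≤ K := by
  refine ⟨⟨(eLpNorm (fun ξ => Θ.yξ ξ - 1) ∞ volume).toReal + 1, by positivity⟩, ?_⟩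
  filter_upwards [ae_abs_le_of_memLp_top h.memE_zeta_xi.2] with ξ hξ
  have := (abs_le.1 hξ).2
  change _ ≤ (eLpNorm (fun ξ => Θ.yξ ξ - 1) ∞ volume).toReal + 1
  linarith

theorem intervalIntegrable_of_bdd {f : ℝ → ℝ} {K : ℝ} (hf : AEStronglyMeasurable f volume)
    (hK : ∀ᵐ x, |f x| ≤ K) (a b : ℝ) : IntervalIntegrable f volume a b :=
  IntervalIntegrable.mono_fun (intervalIntegrable_const (c := K)) hf.restrict (by
    filter_upwards [ae_restrict_of_ae hK] with x hx using hx.trans (le_abs_self K))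

theorem hasACDeriv_y (h : MemG α Θ) {a b : ℝ} (hab : a ≤ b) : HasACDeriv Θ.y Θ.yξ a b := by
  obtain ⟨K, hK⟩ := h.exists_yξ_le
  refine .of_primitive hab (intervalIntegrable_of_bdd h.aesm_yξ (K := K) ?_ a b) fun x _ => ?_
  · filter_upwards [hK, h.nonneg] with x h1 h2 using by rwa [abs_of_nonneg h2.1]
  · linarith [h.deriv_y a x]

theorem hasACDeriv_U (h : MemG α Θ) {a b : ℝ} (hab : a ≤ b) : HasACDeriv Θ.U Θ.Uξ a b :=
  .of_primitive hab
    (intervalIntegrable_of_bdd h.memE_Uξ.1.1 (ae_abs_le_of_memLp_top h.memE_Uξ.2) a b)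
    fun x _ => by linarith [h.deriv_U a x]

theorem monotone_y (h : MemG α Θ) : Monotone Θ.y := by
  intro a b hab
  have h1 : 0 ≤ ∫ ξ in a..b, Θ.yξ ξ := intervalIntegral.integral_nonneg_of_ae hab (by
    filter_upwards [h.nonneg] with x hx using hx.1)
  linarith [h.deriv_y a b]

theorem lipschitz_y (h : MemG α Θ) {K : NNReal} (hK : ∀ᵐ ξ, Θ.yξ ξ ≤ K) :
    LipschitzWith K Θ.y := by
  refine LipschitzWith.of_dist_le_mul fun a b => ?_
  rw [dist_comm, Real.dist_eq, h.deriv_y a b, dist_comm, Real.dist_eq]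
  refine intervalIntegral.norm_integral_le_of_norm_le_const_ae (f := Θ.yξ) (C := K) ?_
  filter_upwards [hK, h.nonneg] with x h1 h2 _
  rw [Real.norm_eq_abs, abs_of_nonneg h2.1]
  exact h1

theorem integrable_hbar (h : MemG α Θ) : Integrable Θ.hbar := by
  refine h.integrable_h.mono h.meas_hbar ?_
  filter_upwards [h.nonneg, h.hbar_le_h] with x h1 h2
  rw [Real.norm_eq_abs, Real.norm_eq_abs, abs_of_nonneg h1.2.2, abs_of_nonneg h1.2.1]
  exact h2

theorem integrable_sq_mul_yξ (h : MemG α Θ) : Integrable fun ξ => Θ.U ξ ^ 2 * Θ.yξ ξ := by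
  obtain ⟨K, hK⟩ := h.exists_yξ_le
  refine h.memE_U.1.integrable_sq.mul_bdd (c := K) h.aesm_yξ ?_
  filter_upwards [hK, h.nonneg] with x h1 h2
  rwa [Real.norm_eq_abs, abs_of_nonneg h2.1]

theorem integrable_edens (h : MemG α Θ) : Integrable Θ.edens :=
  h.integrable_sq_mul_yξ.add h.integrable_hbar

theorem integrable_source (h : MemG α Θ) : Integrable Θ.source := by
  have := (h.integrable_sq_mul_yξ.const_mul 2).add h.integrable_hbar
  refine this.congr (ae_of_all _ fun x => ?_)
  simp only [Pi.add_apply, LagState.source]; ring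

theorem ae_edens_nonneg (h : MemG α Θ) : ∀ᵐ ξ, 0 ≤ Θ.edens ξ := by
  filter_upwards [h.nonneg] with x hx
  exact add_nonneg (mul_nonneg (sq_nonneg _) hx.1) hx.2.2

theorem ae_source (h : MemG α Θ) : ∀ᵐ ξ, 0 ≤ Θ.source ξ ∧ Θ.source ξ ≤ 2 * Θ.edens ξ := by
  filter_upwards [h.nonneg] with x hx
  have := mul_nonneg (sq_nonneg (Θ.U x)) hx.1
  simp only [LagState.source, LagState.edens]
  constructor <;> nlinarith [hx.2.2]

/-- Since `U_ξ² ≤ y_ξ h̄`, the arithmetic-geometric mean inequality bounds `2 |U| √(y_ξ h̄)` by `U²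
y_ξ + h̄`. Thus the energy density dominates `(U²)_ξ`. -/
theorem ae_two_mul_U_mul_Uξ_le (h : MemG α Θ) : ∀ᵐ ξ, |2 * Θ.U ξ * Θ.Uξ ξ| ≤ Θ.edens ξ := by
  filter_upwards [h.nonneg, h.energy_rel, h.ae_edens_nonneg] with x hx hr he
  refine abs_le_of_sq_le_sq ?_ he
  simp only [LagState.edens]
  have h1 : Θ.Uξ x ^ 2 ≤ Θ.yξ x * Θ.hbar x := by nlinarith [sq_nonneg (Θ.r x)]
  nlinarith [mul_le_mul_of_nonneg_left h1 (sq_nonneg (Θ.U x)),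
    sq_nonneg (Θ.U x ^ 2 * Θ.yξ x - Θ.hbar x)]

theorem integrable_U_mul_Uξ (h : MemG α Θ) : Integrable fun ξ => Θ.U ξ * Θ.Uξ ξ :=
  h.memE_U.1.integrable_mul h.memE_Uξ.1

theorem tendsto_U_atTop (h : MemG α Θ) : Tendsto Θ.U atTop (𝓝 0) := by
  have := tendsto_sq_atTop_zero (fun a b => h.hasACDeriv_U) h.memE_U.1.integrable_sq
    h.integrable_U_mul_Uξ
  have := this.sqrt
  simp only [Real.sqrt_sq_eq_abs, Real.sqrt_zero] at this
  exact (tendsto_zero_iff_abs_tendsto_zero _).2 this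

theorem tendsto_U_atBot (h : MemG α Θ) : Tendsto Θ.U atBot (𝓝 0) := by
  have := tendsto_sq_atBot_zero (fun a b => h.hasACDeriv_U) h.memE_U.1.integrable_sq
    h.integrable_U_mul_Uξ
  have := this.sqrt
  simp only [Real.sqrt_sq_eq_abs, Real.sqrt_zero] at this
  exact (tendsto_zero_iff_abs_tendsto_zero _).2 this

theorem energy_nonneg (h : MemG α Θ) : 0 ≤ Θ.energy := integral_nonneg_of_ae h.ae_edens_nonneg

/-- `U²` vanishes at `-∞` and its derivative is dominated by the energy density. -/
theorem U_sq_le (h : MemG α Θ) (ξ : ℝ) : Θ.U ξ ^ 2 ≤ Θ.energy := by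
  have h0 : Tendsto (fun a => Θ.U ξ ^ 2 - Θ.U a ^ 2) atBot (𝓝 (Θ.U ξ ^ 2 - 0 ^ 2)) :=
    (h.tendsto_U_atBot.pow 2).const_sub _
  rw [zero_pow two_ne_zero, sub_zero] at h0
  refine le_of_tendsto h0 ?_
  filter_upwards [eventually_le_atBot ξ] with a ha
  rw [← (h.hasACDeriv_U ha).pow_two.integral_eq_sub]
  refine (intervalIntegral.integral_mono_ae ha (h.hasACDeriv_U ha).pow_two.intervalIntegrable
    h.integrable_edens.intervalIntegrable ?_).trans ?_
  · filter_upwards [h.ae_two_mul_U_mul_Uξ_le] with x hx using (le_abs_self _).trans hx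
  · rw [intervalIntegral.integral_of_le ha]
    exact setIntegral_le_integral h.integrable_edens h.ae_edens_nonneg

theorem abs_integral_source_le (h : MemG α Θ) {f : ℝ → ℝ} (hf : ∀ η, |f η| ≤ 1) :
    |∫ η, f η * Θ.source η| ≤ 2 * Θ.energy := by
  have h2 : ∫ η, 2 * Θ.edens η = 2 * Θ.energy := integral_const_mul _ _
  rw [← h2]
  rw [← Real.norm_eq_abs]
  refine norm_integral_le_of_norm_le (f := fun η => f η * Θ.source η)
    (h.integrable_edens.const_mul 2) ?_
  filter_upwards [h.ae_source] with x hx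
  rw [Real.norm_eq_abs, abs_mul, abs_of_nonneg hx.1]
  nlinarith [hf x, hx.1, hx.2, mul_le_mul_of_nonneg_right (hf x) hx.1]

theorem abs_P_le (h : MemG α Θ) (ξ : ℝ) : |Θ.P ξ| ≤ Θ.energy := by
  have h1 := h.abs_integral_source_le (f := fun η => Θ.ker ξ η) fun η => by
    rw [abs_of_pos (Θ.ker_pos _ _)]; exact Θ.ker_le_one _ _
  rw [Θ.P_eq, abs_mul, abs_of_pos (by norm_num : (0 : ℝ) < 1 / 4)]
  linarith [h.energy_nonneg]

theorem abs_sign_mul_ker_le (ξ η : ℝ) : |Real.sign (ξ - η) * Θ.ker ξ η| ≤ 1 := by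
  rw [abs_mul, abs_of_pos (Θ.ker_pos _ _)]
  exact mul_le_one₀ (abs_sign_le_one _) (Θ.ker_pos _ _).le (Θ.ker_le_one _ _)

theorem abs_Q_le (h : MemG α Θ) (ξ : ℝ) : |Θ.Q ξ| ≤ Θ.energy := by
  have h1 := h.abs_integral_source_le (abs_sign_mul_ker_le (Θ := Θ) ξ)
  rw [Θ.Q_eq, abs_mul, abs_neg, abs_of_pos (by norm_num : (0 : ℝ) < 1 / 4)]
  linarith [h.energy_nonneg]

theorem abs_sq_sub_P_le (h : MemG α Θ) (ξ : ℝ) : |Θ.U ξ ^ 2 - Θ.P ξ| ≤ 2 * Θ.energy := by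
  have h1 := abs_sub (Θ.U ξ ^ 2) (Θ.P ξ)
  rw [abs_of_nonneg (sq_nonneg (Θ.U ξ))] at h1
  linarith [h.U_sq_le ξ, h.abs_P_le ξ]

theorem continuous_y (h : MemG α Θ) : Continuous Θ.y := by
  obtain ⟨K, hK⟩ := h.exists_yξ_le
  exact (h.lipschitz_y hK).continuous

/-- The kernel is absolutely continuous in the first variable. -/
theorem hasACDeriv_ker (h : MemG α Θ) {a b : ℝ} (hab : a ≤ b) (η : ℝ) :
    HasACDeriv (fun ξ => Θ.ker ξ η) (fun ξ => -(Real.sign (ξ - η) * Θ.ker ξ η) * Θ.yξ ξ) a b := by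
  obtain ⟨K, hK⟩ := h.exists_yξ_le
  constructor
  · refine LipschitzOnWith.absolutelyContinuousOnInterval (K := K)
      (LipschitzWith.lipschitzOnWith (LipschitzWith.of_dist_le_mul fun u v => ?_))
    refine le_trans ?_ ((h.lipschitz_y hK).dist_le_mul u v)
    refine (abs_exp_neg_sub_le (abs_nonneg _) (abs_nonneg _)).trans ?_
    refine (abs_abs_sub_abs_le _ _).trans (le_of_eq ?_)
    rw [Real.dist_eq]; congr 1; ring
  · have hne : ∀ᵐ x : ℝ, x ≠ η := by simp [ae_iff, measure_singleton]
    filter_upwards [(h.hasACDeriv_y hab).deriv, hne] with x hx hne hm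
    have hd := hx hm
    -- Monotonicity of `y` fixes the sign of `y ξ - y η` on each side of `η`, so the absolute value
    -- opens according to the sign of `ξ - η` even where `y` is constant.
    rcases lt_or_gt_of_ne hne with hlt | hgt
    · have h1 : (fun ξ => Θ.ker ξ η) =ᶠ[𝓝 x] fun ξ => Real.exp (Θ.y ξ - Θ.y η) := by
        filter_upwards [Iio_mem_nhds hlt] with z hz
        have := h.monotone_y (le_of_lt hz)
        rw [LagState.ker, abs_of_nonpos (by linarith), neg_neg]
      refine ((hd.sub_const _).exp.congr_of_eventuallyEq h1).congr_deriv ?_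
      have h2 : Θ.ker x η = Real.exp (Θ.y x - Θ.y η) := h1.self_of_nhds
      rw [h2, Real.sign_of_neg (by linarith)]; ring
    · have h1 : (fun ξ => Θ.ker ξ η) =ᶠ[𝓝 x] fun ξ => Real.exp (-(Θ.y ξ - Θ.y η)) := by
        filter_upwards [Ioi_mem_nhds hgt] with z hz
        have := h.monotone_y (le_of_lt hz)
        rw [LagState.ker, abs_of_nonneg (by linarith)]
      refine ((hd.sub_const _).neg.exp.congr_of_eventuallyEq h1).congr_deriv ?_
      have h2 : Θ.ker x η = Real.exp (-(Θ.y x - Θ.y η)) := h1.self_of_nhds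
      rw [h2, Real.sign_of_pos (by linarith)]
      simp only [Pi.neg_apply]; ring

theorem measurable_ker (h : MemG α Θ) : Measurable fun p : ℝ × ℝ => Θ.ker p.1 p.2 := by
  have := h.continuous_y
  unfold LagState.ker
  fun_prop

theorem integrable_ker_mul_source (h : MemG α Θ) (ξ : ℝ) :
    Integrable fun η => Θ.ker ξ η * Θ.source η := by
  refine h.integrable_source.bdd_mul (c := 1)
    (h.measurable_ker.comp measurable_prodMk_left).aestronglyMeasurable (ae_of_all _ fun η => ?_)
  rw [Real.norm_eq_abs, abs_of_pos (Θ.ker_pos _ _)]; exact Θ.ker_le_one _ _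

theorem integrable_flux_kernel (h : MemG α Θ) {a b : ℝ} (hab : a ≤ b) :
    Integrable (Function.uncurry fun ξ η =>
      -(Real.sign (ξ - η) * Θ.ker ξ η) * Θ.yξ ξ * Θ.source η)
      ((volume.restrict (uIoc a b)).prod volume) := by
  have h1 : Integrable Θ.yξ (volume.restrict (uIoc a b)) :=
    intervalIntegrable_iff.1 (h.hasACDeriv_y hab).intervalIntegrable
  have h2 := h1.mul_prod h.integrable_source
  refine (h2.bdd_mul (c := 1) (f := fun p : ℝ × ℝ => -(Real.sign (p.1 - p.2) * Θ.ker p.1 p.2))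
    ?_ (ae_of_all _ fun p => ?_)).congr (ae_of_all _ fun p => ?_)
  · exact (((measurable_sign.comp (measurable_fst.sub measurable_snd)).mul
      h.measurable_ker).neg).aestronglyMeasurable
  · rw [norm_neg]; exact abs_sign_mul_ker_le _ _
  · simp only [Function.uncurry]; ring

theorem integral_flux_kernel (ξ : ℝ) :
    ∫ η, -(Real.sign (ξ - η) * Θ.ker ξ η) * Θ.yξ ξ * Θ.source η = 4 * (Θ.Q ξ * Θ.yξ ξ) := by
  have : ∀ η, -(Real.sign (ξ - η) * Θ.ker ξ η) * Θ.yξ ξ * Θ.source η =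
      -Θ.yξ ξ * (Real.sign (ξ - η) * Θ.ker ξ η * Θ.source η) := fun η => by ring
  simp_rw [this]
  rw [integral_const_mul, Θ.Q_eq]; ring

/-- `P_ξ = Q y_ξ`. -/
theorem hasACDeriv_P (h : MemG α Θ) {a b : ℝ} (hab : a ≤ b) :
    HasACDeriv Θ.P (fun ξ => Θ.Q ξ * Θ.yξ ξ) a b := by
  refine .of_primitive hab ?_ fun x hx => ?_
  · have := (h.integrable_flux_kernel hab).integral_prod_left
    simp only [Function.uncurry, integral_flux_kernel] at this
    rw [intervalIntegrable_iff]
    refine (this.const_mul (1 / 4)).congr (ae_of_all _ fun x => ?_)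
    simp only; ring
  -- By Fubini, the integral of `4 Q y_ξ` over the labels becomes the integral of the increments of
  -- the kernel against the source.
  · have h1 := intervalIntegral_integral_swap (h.integrable_flux_kernel hx.1)
    simp only [integral_flux_kernel, intervalIntegral.integral_mul_const,
      (h.hasACDeriv_ker hx.1 _).integral_eq_sub, intervalIntegral.integral_const_mul] at h1
    simp only [sub_mul] at h1
    rw [integral_sub (h.integrable_ker_mul_source x) (h.integrable_ker_mul_source a)] at h1
    rw [Θ.P_eq, Θ.P_eq]
    linarith

end MemG

/-! ### Energy bounds from the norm, and non-accumulation of breaking times. -/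

section

theorem integral_sq_le {f : ℝ → ℝ} (hf : MemLp f 2 volume) {N : ℝ} (hN : 0 ≤ N)
    (h : eLpNorm f 2 volume ≤ ENNReal.ofReal N) : ∫ x, f x ^ 2 ≤ N ^ 2 := by
  rw [hf.eLpNorm_eq_integral_rpow_norm two_ne_zero ENNReal.ofNat_ne_top,
    ENNReal.ofReal_le_ofReal_iff hN] at h
  simp only [ENNReal.toReal_ofNat, Real.rpow_two, Real.norm_eq_abs, sq_abs] at h
  have h0 : 0 ≤ ∫ x, f x ^ 2 := integral_nonneg fun x => sq_nonneg _
  have h1 := pow_le_pow_left₀ (Real.rpow_nonneg h0 _) h 2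
  rwa [← Real.rpow_natCast, ← Real.rpow_mul h0, Nat.cast_ofNat, inv_mul_cancel₀ two_ne_zero,
    Real.rpow_one] at h1

theorem ae_abs_le_of_eLpNorm_le {f : ℝ → ℝ} (hf : MemLp f ∞ volume) {N : ℝ} (hN : 0 ≤ N)
    (h : eLpNorm f ∞ volume ≤ ENNReal.ofReal N) : ∀ᵐ x, |f x| ≤ N := by
  filter_upwards [ae_abs_le_of_memLp_top hf] with x hx
  exact hx.trans (ENNReal.toReal_le_of_le_ofReal hN h)

theorem normE_le_add {f g : ℝ → ℝ} (hf : AEStronglyMeasurable f volume)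
    (hg : AEStronglyMeasurable g volume) :
    normE f ≤ normE (fun x => f x - g x) + normE g := by
  have h : ∀ p : ℝ≥0∞, 1 ≤ p → eLpNorm f p volume ≤
      eLpNorm (fun x => f x - g x) p volume + eLpNorm g p volume := fun p hp => by
    have := eLpNorm_add_le (hf.sub hg) hg hp
    rwa [sub_add_cancel] at this
  unfold normE
  calc _ ≤ _ := add_le_add (h 2 one_le_two) (h ∞ le_top)
    _ = _ := by ring

namespace MemG

variable {α : ℝ} {Θ Θ' : LagState}

theorem normX_le_add (h : MemG α Θ) (h' : MemG α Θ') : Θ.normX ≤ Θ.distX Θ' + Θ'.normX := by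
  have h0 : eLpNorm (fun ξ => Θ.y ξ - ξ) ∞ volume ≤
      eLpNorm (fun ξ => Θ.y ξ - Θ'.y ξ) ∞ volume + eLpNorm (fun ξ => Θ'.y ξ - ξ) ∞ volume := by
    have := eLpNorm_add_le (p := ∞) (h.aesm_y.sub h'.aesm_y) h'.memLp_zeta.1 le_top
    have e : (fun ξ => Θ.y ξ - ξ) = Θ.y - Θ'.y + fun ξ => Θ'.y ξ - ξ := by ext ξ; simp
    rw [e]
    exact this
  have h1 : normE (fun ξ => Θ.yξ ξ - 1) ≤
      normE (fun ξ => Θ.yξ ξ - Θ'.yξ ξ) + normE (fun ξ => Θ'.yξ ξ - 1) := by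
    have := normE_le_add h.memE_zeta_xi.1.1 h'.memE_zeta_xi.1.1
    simpa only [sub_sub_sub_cancel_right] using this
  unfold LagState.normX LagState.distX normV
  calc _ ≤ _ := add_le_add (add_le_add (add_le_add (add_le_add (add_le_add h0
          (normE_le_add h.memE_U.1.1 h'.memE_U.1.1)) h1)
          (normE_le_add h.memE_Uξ.1.1 h'.memE_Uξ.1.1))
          (normE_le_add h.memE_h.1.1 h'.memE_h.1.1))
          (normE_le_add h.memE_r.1.1 h'.memE_r.1.1)
    _ = _ := by ring

theorem normE_lt_top {f : ℝ → ℝ} (h : MemE f) : normE f < ∞ := ENNReal.add_lt_top.2 ⟨h.1.2, h.2.2⟩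

theorem normX_lt_top (h : MemG α Θ) : Θ.normX < ∞ := by
  simp only [LagState.normX, normV, ENNReal.add_lt_top]
  exact ⟨⟨⟨⟨⟨h.memLp_zeta.2, normE_lt_top h.memE_U⟩, normE_lt_top h.memE_zeta_xi⟩,
    normE_lt_top h.memE_Uξ⟩, normE_lt_top h.memE_h⟩, normE_lt_top h.memE_r⟩

theorem ae_abs_yξ_sub_one_le (h : MemG α Θ) {N : ℝ} (hN : 0 ≤ N)
    (hX : Θ.normX ≤ ENNReal.ofReal N) : ∀ᵐ ξ, |Θ.yξ ξ - 1| ≤ N := by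
  refine ae_abs_le_of_eLpNorm_le h.memE_zeta_xi.2 hN (le_trans ?_ hX)
  unfold LagState.normX normV
  exact le_add_right (le_add_right (le_add_right (le_add_left le_add_self)))

theorem ae_abs_Uξ_le (h : MemG α Θ) {N : ℝ} (hN : 0 ≤ N)
    (hX : Θ.normX ≤ ENNReal.ofReal N) : ∀ᵐ ξ, |Θ.Uξ ξ| ≤ N := by
  refine ae_abs_le_of_eLpNorm_le h.memE_Uξ.2 hN (le_trans ?_ hX)
  unfold LagState.normX normV
  exact le_add_right (le_add_right (le_add_left le_add_self))

/-- The energy is bounded by the norm of the state. -/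
theorem energy_le (h : MemG α Θ) {N : ℝ} (hN : 0 ≤ N) (hX : Θ.normX ≤ ENNReal.ofReal N) :
    Θ.energy ≤ 5 * N ^ 2 + 5 * N ^ 3 := by
  have hE : ∀ {f : ℝ → ℝ}, normE f ≤ ENNReal.ofReal N → eLpNorm f 2 volume ≤ ENNReal.ofReal N :=
    fun hf => le_self_add.trans hf
  have bU : normE Θ.U ≤ ENNReal.ofReal N := by
    refine le_trans ?_ hX
    unfold LagState.normX normV
    exact le_add_right (le_add_right (le_add_right (le_add_right le_add_self)))
  have bz : normE (fun ξ => Θ.yξ ξ - 1) ≤ ENNReal.ofReal N := by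
    refine le_trans ?_ hX
    unfold LagState.normX normV
    exact le_add_right (le_add_right (le_add_right le_add_self))
  have bw : normE Θ.Uξ ≤ ENNReal.ofReal N := by
    refine le_trans ?_ hX
    unfold LagState.normX normV
    exact le_add_right (le_add_right le_add_self)
  have bh : normE Θ.h ≤ ENNReal.ofReal N := by
    refine le_trans ?_ hX
    unfold LagState.normX normV
    exact le_add_right le_add_self
  have br : normE Θ.r ≤ ENNReal.ofReal N := by
    refine le_trans ?_ hX
    unfold LagState.normX normV
    exact le_add_self
  have iU := h.memE_U.1.integrable_sq
  have iz := h.memE_zeta_xi.1.integrable_sq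
  have iw := h.memE_Uξ.1.integrable_sq
  have ir := h.memE_r.1.integrable_sq
  have key : Θ.energy ≤ ∫ ξ, ((1 + N) * Θ.U ξ ^ 2 + 2 * Θ.Uξ ξ ^ 2 + 2 * Θ.r ξ ^ 2
      + 4 * N * (Θ.yξ ξ - 1) ^ 2) := by
    refine integral_mono_ae h.integrable_edens
      ((((iU.const_mul _).add (iw.const_mul _)).add (ir.const_mul _)).add (iz.const_mul _)) ?_
    filter_upwards [h.ae_abs_yξ_sub_one_le hN hX,
      ae_abs_le_of_eLpNorm_le h.memE_h.2 hN (le_add_self.trans bh),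
      h.nonneg, h.hbar_le_h, h.energy_rel] with ξ h1 h2 h3 h4 h5
    have h6 := (abs_le.1 h1).2
    have h7 := (abs_le.1 h2).2
    have h8 : Θ.U ξ ^ 2 * Θ.yξ ξ ≤ (1 + N) * Θ.U ξ ^ 2 := by nlinarith [sq_nonneg (Θ.U ξ)]
    -- Where `y_ξ ≥ 1/2`, `h̄ ≤ 2 y_ξ h̄ = 2 U_ξ² + 2 r²`. Elsewhere `(y_ξ - 1)² ≥ 1/4`, so `h̄ ≤ h
    -- ≤ N ≤ 4N (y_ξ - 1)²`.
    have h9 : Θ.hbar ξ ≤ 2 * Θ.Uξ ξ ^ 2 + 2 * Θ.r ξ ^ 2 + 4 * N * (Θ.yξ ξ - 1) ^ 2 := by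
      have h11 := mul_nonneg hN (sq_nonneg (Θ.yξ ξ - 1))
      rcases le_total (1 / 2) (Θ.yξ ξ) with hc | hc
      · nlinarith [mul_le_mul_of_nonneg_right hc h3.2.2]
      · have h10 : 1 / 4 ≤ (Θ.yξ ξ - 1) ^ 2 := by nlinarith
        nlinarith [sq_nonneg (Θ.Uξ ξ), sq_nonneg (Θ.r ξ), mul_le_mul_of_nonneg_left h10 hN]
    simp only [LagState.edens]
    linarith
  have i2 := (iU.const_mul (1 + N)).add (iw.const_mul 2)
  have i3 := i2.add (ir.const_mul 2)
  have a1 := integral_add i3 (iz.const_mul (4 * N))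
  have a2 := integral_add i2 (ir.const_mul 2)
  have a3 := integral_add (iU.const_mul (1 + N)) (iw.const_mul 2)
  simp only [Pi.add_apply, integral_const_mul] at a1 a2 a3
  rw [a1, a2, a3] at key
  have e1 := integral_sq_le h.memE_U.1 hN (hE bU)
  have e2 := integral_sq_le h.memE_Uξ.1 hN (hE bw)
  have e3 := integral_sq_le h.memE_r.1 hN (hE br)
  have e4 := integral_sq_le h.memE_zeta_xi.1 hN (hE bz)
  have e5 := mul_le_mul_of_nonneg_left e1 (by linarith : 0 ≤ 1 + N)
  have e6 := mul_le_mul_of_nonneg_left e4 (by linarith : 0 ≤ 4 * N)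
  nlinarith

end MemG

variable {α : ℝ} {Θ₀ : LagState} {Θ : ℝ → LagState} {ξ : ℝ}

/-- A solution is bounded on compact time intervals. -/
theorem IsGlobalSolution.exists_normX_le (h : IsGlobalSolution α Θ₀ Θ) (T : ℝ) :
    ∃ N : ℝ, 0 ≤ N ∧ ∀ t ∈ Icc 0 T, (Θ t).normX ≤ ENNReal.ofReal N := by
  suffices H : ∃ N : ℝ≥0∞, N ≠ ∞ ∧ ∀ t ∈ Icc 0 T, (Θ t).normX ≤ N by
    obtain ⟨N, hN, H⟩ := H
    exact ⟨N.toReal, ENNReal.toReal_nonneg, by rwa [ENNReal.ofReal_toReal hN]⟩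
  -- Continuity bounds the norm near each time, and finitely many such neighbourhoods cover `[0,
  -- T]`.
  refine isCompact_Icc.induction_on
    (p := fun s => ∃ N : ℝ≥0∞, N ≠ ∞ ∧ ∀ t ∈ s, (Θ t).normX ≤ N) ⟨0, by simp, by simp⟩
    (fun s t hst ⟨N, hN, H⟩ => ⟨N, hN, fun x hx => H x (hst hx)⟩)
    (fun s t ⟨N, hN, H⟩ ⟨N', hN', H'⟩ => ⟨N ⊔ N', (max_lt hN.lt_top hN'.lt_top).ne, ?_⟩) ?_
  · rintro x (hx | hx)
    · exact (H x hx).trans le_sup_left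
    · exact (H' x hx).trans le_sup_right
  · intro t₀ ht₀
    refine ⟨{t | 0 ≤ t ∧ (Θ t).distX (Θ t₀) < 1}, ?_, 1 + (Θ t₀).normX,
      ENNReal.add_ne_top.2 ⟨ENNReal.one_ne_top, (h.memG t₀ ht₀.1).normX_lt_top.ne⟩, ?_⟩
    · have h1 := (h.continuous t₀ ht₀.1).mono_left (nhdsWithin_mono t₀ (fun _ hx => hx.1 : Icc 0 T ⊆ Ici 0))
      filter_upwards [h1.eventually (gt_mem_nhds one_pos), self_mem_nhdsWithin (s := Icc 0 T)]
        with t ht ht' using ⟨ht'.1, ht⟩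
    · intro t ht
      exact ((h.memG t ht.1).normX_le_add (h.memG t₀ ht₀.1)).trans
        (add_le_add_left ht.2.le _)

/-- Continuity in time is available in the norm of `X` only, so it matters that the energy is
bounded by that norm without the `L¹` norm of `h`. -/
theorem IsGlobalSolution.exists_energy_le (h : IsGlobalSolution α Θ₀ Θ) (T : ℝ) :
    ∃ B : ℝ, 0 ≤ B ∧ ∀ t ∈ Icc 0 T, (Θ t).energy ≤ B := by
  obtain ⟨N, hN, H⟩ := h.exists_normX_le T
  exact ⟨5 * N ^ 2 + 5 * N ^ 3, by positivity,
    fun t ht => (h.memG t ht.1).energy_le hN (H t ht)⟩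

theorem exists_le_tau {T δ : ℝ} (hT : 0 ≤ T) (hδ : 0 < δ)
    (H : ∀ (n : ℕ) (s : ℝ), n ≠ 0 → s ≤ T → tau Θ n ξ = s →
      ((min (s + δ) T : ℝ) : EReal) < tau Θ (n + 1) ξ) : ∃ n, (T : EReal) ≤ tau Θ n ξ := by
  -- The index is shifted because nothing keeps `τ₁` away from `0`; each later breaking costs `δ`,
  -- as long as it stays below `T`, where the bounds behind `H` end.
  have key : ∀ n : ℕ, ((min (n * δ) T : ℝ) : EReal) ≤ tau Θ (n + 1) ξ := by
    intro n
    induction n with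
    | zero =>
      simp only [Nat.cast_zero, zero_mul, min_eq_left hT]
      exact breakSeq_nonneg _ _
    | succ n ih =>
      have hmono : tau Θ (n + 1) ξ ≤ tau Θ (n + 1 + 1) ξ := le_nextBreak _ _
      by_cases hc : (T : EReal) ≤ tau Θ (n + 1) ξ
      · exact (EReal.coe_le_coe_iff.2 (min_le_right _ _)).trans (hc.trans hmono)
      · obtain ⟨s, -, hs⟩ := exists_real_of_breakSeq_lt_top
          ((not_le.1 hc).trans (EReal.coe_lt_top T))
        change tau Θ (n + 1) ξ = s at hs
        rw [hs] at ih hc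
        have hsT : s ≤ T := by
          rw [not_le] at hc; exact (EReal.coe_lt_coe_iff.1 hc).le
        refine le_trans ?_ (H (n + 1) s n.succ_ne_zero hsT hs).le
        rw [EReal.coe_le_coe_iff] at ih ⊢
        refine le_min ?_ (min_le_right _ _)
        rcases le_total (n * δ) T with h1 | h1
        · rw [min_eq_left h1] at ih
          refine (min_le_left _ _).trans ?_
          push_cast; linarith
        · rw [min_eq_right h1] at ih
          exact (min_le_right _ _).trans (by linarith)
  obtain ⟨n, hn⟩ := exists_nat_ge (T / δ)
  refine ⟨n + 1, ?_⟩
  have := key n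
  rwa [min_eq_right ((div_le_iff₀ hδ).1 hn)] at this

/-- Breaking times do not accumulate. -/
theorem IsGlobalSolution.tendsto_tau (h : IsGlobalSolution α Θ₀ Θ) (hα : α ≤ 1)
    (hξ : ξ ∈ regularLabels α Θ) : Tendsto (fun n => tau Θ n ξ) atTop (𝓝 ⊤) := by
  have hex : ∀ T : ℝ, 0 ≤ T → ∃ n, (T : EReal) ≤ tau Θ n ξ := by
    intro T hT
    obtain ⟨B, hB, H⟩ := h.exists_energy_le T
    have hpos : 0 < 8 * (2 * (2 * B) + 1) := by linarith
    refine exists_le_tau hT (inv_pos.2 hpos) fun n s hn hsT hs => ?_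
    have hs0 : 0 ≤ s := by
      have := breakSeq_nonneg (fun t => (Θ t).yξ ξ) n
      change 0 ≤ tau Θ n ξ at this
      rw [hs] at this
      exact EReal.coe_nonneg.1 this
    refine (waiting_time hα hξ hn hs (by linarith : 0 ≤ 2 * B) ?_ fun t ht => ?_).1
    · have h1 : min (s + (8 * (2 * (2 * B) + 1))⁻¹) T - s ≤ (8 * (2 * (2 * B) + 1))⁻¹ := by
        linarith [min_le_left (s + (8 * (2 * (2 * B) + 1))⁻¹) T]
      exact (mul_le_mul_of_nonneg_left h1 hpos.le).trans (mul_inv_cancel₀ hpos.ne').le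
    · have ht' : t ∈ Icc 0 T := ⟨hs0.trans ht.1, ht.2.trans (min_le_right _ _)⟩
      exact ((h.memG t ht'.1).abs_sq_sub_P_le ξ).trans (by linarith [H t ht'])
  rw [EReal.tendsto_nhds_top_iff_real]
  intro x
  obtain ⟨n, hn⟩ := hex (|x| + 1) (by positivity)
  filter_upwards [eventually_ge_atTop n] with m hm
  refine (EReal.coe_lt_coe_iff.2 (by linarith [le_abs_self x])).trans_le
    (hn.trans (breakSeq_monotone _ hm))

/-- Every time lies in one of the intervals between successive breaking times. -/
theorem exists_mem_interval (h : Tendsto (fun n => tau Θ n ξ) atTop (𝓝 ⊤)) {t : ℝ} (ht : 0 ≤ t) :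
    ∃ (n : ℕ) (s : ℝ), tau Θ n ξ = s ∧ s ≤ t ∧ (t : EReal) < tau Θ (n + 1) ξ := by
  classical
  have hex : ∃ n, (t : EReal) < tau Θ n ξ :=
    ((EReal.tendsto_nhds_top_iff_real.1 h) t).exists
  obtain ⟨m, hm⟩ : ∃ m, Nat.find hex = m + 1 := by
    refine Nat.exists_eq_succ_of_ne_zero fun h0 => ?_
    have h1 := Nat.find_spec hex
    rw [h0] at h1
    exact absurd h1 (not_lt.2 (EReal.coe_nonneg.2 ht))
  have h1 := Nat.find_spec hex
  rw [hm] at h1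
  have h2 : tau Θ m ξ ≤ t := not_lt.1 (Nat.find_min hex (by omega))
  obtain ⟨s, -, hs⟩ := exists_real_of_breakSeq_lt_top (h2.trans_lt (EReal.coe_lt_top t))
  change tau Θ m ξ = s at hs
  rw [hs] at h2
  exact ⟨m, s, hs, EReal.coe_le_coe_iff.1 h2, h1⟩

end

/-! ### Joint measurability in time and label. -/

theorem exists_approx_from_right : ∃ (θ : ℕ → ℕ → ℝ) (κ : ℕ → ℝ → ℕ), (∀ n k, 0 ≤ θ n k) ∧
    (∀ n, Measurable (κ n)) ∧
    ∀ t, 0 ≤ t → Tendsto (fun n => θ n (κ n t)) atTop (𝓝[>] t) := by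
  -- The next point after `t` of the grid of mesh `1 / (n + 1)`; the `+ 1` in the numerator puts it
  -- strictly to the right of `t`.
  refine ⟨fun n k => ((k : ℝ) + 1) / ((n : ℝ) + 1), fun n t => ⌊((n : ℝ) + 1) * t⌋₊,
    fun n k => by positivity, fun n => Nat.measurable_floor.comp (measurable_id.const_mul _),
    fun t ht => ?_⟩
  have hb : ∀ n : ℕ, t < ((⌊((n : ℝ) + 1) * t⌋₊ : ℝ) + 1) / ((n : ℝ) + 1) ∧
      ((⌊((n : ℝ) + 1) * t⌋₊ : ℝ) + 1) / ((n : ℝ) + 1) ≤ t + 1 / ((n : ℝ) + 1) := by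
    intro n
    have hn : (0 : ℝ) < (n : ℝ) + 1 := by positivity
    have h1 := Nat.lt_floor_add_one (((n : ℝ) + 1) * t)
    have h2 := Nat.floor_le (mul_nonneg hn.le ht)
    constructor
    · rw [lt_div_iff₀ hn]; linarith
    · rw [add_div]
      gcongr
      rw [div_le_iff₀ hn]; linarith
  refine tendsto_nhdsWithin_iff.2 ⟨?_, Eventually.of_forall fun n => (hb n).1⟩
  refine tendsto_of_tendsto_of_tendsto_of_le_of_le tendsto_const_nhds ?_
    (fun n => (hb n).1.le) fun n => (hb n).2
  simpa using (tendsto_one_div_add_atTop_nhds_zero_nat (𝕜 := ℝ)).const_add t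

/-- A function of time and label that is measurable in the label and right-continuous in time is
jointly measurable. -/
theorem aestronglyMeasurable_of_rightContinuous {F : ℝ → ℝ → ℝ}
    (hm : ∀ t, 0 ≤ t → AEStronglyMeasurable (F t) volume)
    (hc : ∀ᵐ ξ, ∀ t, 0 ≤ t → Tendsto (fun t' => F t' ξ) (𝓝[>] t) (𝓝 (F t ξ))) :
    AEStronglyMeasurable (fun p : ℝ × ℝ => F p.1 p.2)
      ((volume.restrict (Ici 0)).prod volume) := by
  obtain ⟨θ, κ, hθ0, hκ, hθκ⟩ := exists_approx_from_right
  -- Only countably many grid times occur, so the measurable representatives agree with `F` off one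
  -- null set of labels.
  choose g hg hFg using fun n k => hm (θ n k) (hθ0 n k)
  have hg' : ∀ n, Measurable fun p : ℝ × ℝ => g n (κ n p.1) p.2 := fun n => by
    have h1 : Measurable fun p : ℕ × ℝ => g n p.1 p.2 :=
      measurable_from_prod_countable_right fun k => (hg n k).measurable
    exact h1.comp (((hκ n).comp measurable_fst).prodMk measurable_snd)
  refine aestronglyMeasurable_of_tendsto_ae atTop (f := fun n p => g n (κ n p.1) p.2)
    (fun n => (hg' n).aestronglyMeasurable) ?_
  have hmk : ∀ᵐ ξ : ℝ, ∀ n k, F (θ n k) ξ = g n k ξ :=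
    ae_all_iff.2 fun n => ae_all_iff.2 fun k => hFg n k
  have h1 := (Measure.quasiMeasurePreserving_snd (μ := volume.restrict (Ici (0 : ℝ)))
    (ν := (volume : Measure ℝ))).ae (hmk.and hc)
  have h2 := (Measure.quasiMeasurePreserving_fst (μ := volume.restrict (Ici (0 : ℝ)))
    (ν := (volume : Measure ℝ))).ae (ae_restrict_mem measurableSet_Ici)
  filter_upwards [h1, h2] with p hp hp0
  refine ((hp.2 p.1 hp0).comp (hθκ p.1 hp0)).congr fun n => ?_
  exact hp.1 n (κ n p.1)

/-- Covers `P` with `c = 1` and `Q` with `c` the sign of the label difference. The integrand lives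
on triples `(t, ξ, η)`, to which `y` and `s` are pulled back along projections that respect null
sets. -/
theorem aesm_nonlocal {μ : Measure ℝ} [SFinite μ] {c : ℝ × ℝ → ℝ} {y s : ℝ → ℝ → ℝ}
    (hc : Measurable c)
    (hy : AEStronglyMeasurable (fun p : ℝ × ℝ => y p.1 p.2) (μ.prod volume))
    (hs : AEStronglyMeasurable (fun p : ℝ × ℝ => s p.1 p.2) (μ.prod volume)) :
    AEStronglyMeasurable
      (fun p : ℝ × ℝ => ∫ η, c (p.2, η) * Real.exp (-|y p.1 p.2 - y p.1 η|) * s p.1 η)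
      (μ.prod volume) := by
  have q1 : Measure.QuasiMeasurePreserving (Prod.fst : (ℝ × ℝ) × ℝ → ℝ × ℝ)
      ((μ.prod volume).prod volume) (μ.prod volume) := Measure.quasiMeasurePreserving_fst
  have q2 : Measure.QuasiMeasurePreserving (Prod.map Prod.fst id : (ℝ × ℝ) × ℝ → ℝ × ℝ)
      ((μ.prod volume).prod volume) (μ.prod volume) :=
    MeasureTheory.QuasiMeasurePreserving.prodMap Measure.quasiMeasurePreserving_fst
      (Measure.QuasiMeasurePreserving.id _)
  have h1 : AEStronglyMeasurable (fun p : (ℝ × ℝ) × ℝ => y p.1.1 p.1.2)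
      ((μ.prod volume).prod volume) := hy.comp_quasiMeasurePreserving q1
  have h2 : AEStronglyMeasurable (fun p : (ℝ × ℝ) × ℝ => y p.1.1 p.2)
      ((μ.prod volume).prod volume) := hy.comp_quasiMeasurePreserving q2
  have h3 : AEStronglyMeasurable (fun p : (ℝ × ℝ) × ℝ => s p.1.1 p.2)
      ((μ.prod volume).prod volume) := hs.comp_quasiMeasurePreserving q2
  have h4 : AEStronglyMeasurable (fun p : (ℝ × ℝ) × ℝ => c (p.1.2, p.2))
      ((μ.prod volume).prod volume) :=
    (hc.comp ((measurable_snd.comp measurable_fst).prodMk measurable_snd)).aestronglyMeasurable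
  have h5 : AEStronglyMeasurable
      (fun p : (ℝ × ℝ) × ℝ => Real.exp (-|y p.1.1 p.1.2 - y p.1.1 p.2|))
      ((μ.prod volume).prod volume) :=
    Real.continuous_exp.comp_aestronglyMeasurable (h1.sub h2).norm.neg
  exact ((h4.mul h5).mul h3).integral_prod_right'

/-- The half-open interval includes its starting point `s`, so even `h̄` is right-continuous at a
breaking time, where it has taken its reduced value. -/
theorem SolvesOn.tendsto_right {f F : ℝ → ℝ} {s t : ℝ} {e : EReal} (h : SolvesOn f F s e)
    (hst : s ≤ t) (hte : (t : EReal) < e) : Tendsto f (𝓝[>] t) (𝓝 (f t)) := by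
  obtain ⟨u, htu, hue⟩ := EReal.lt_iff_exists_real_btwn.1 hte
  rw [EReal.coe_lt_coe_iff] at htu
  have hc := (h.hasACDeriv (hst.trans htu.le) hue).ac.continuousOn
  rw [uIcc_of_le (hst.trans htu.le)] at hc
  refine (hc t ⟨hst, htu.le⟩).mono_left (nhdsWithin_le_iff.2 ?_)
  filter_upwards [Ioo_mem_nhdsGT htu] with x hx using ⟨hst.trans hx.1.le, hx.2.le⟩

/-! ### Energy balance along a label. -/

/-- The time derivative of the energy density. -/
def LagState.flux (Θ : LagState) (ξ : ℝ) : ℝ :=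
  3 * Θ.U ξ ^ 2 * Θ.Uξ ξ - 2 * Θ.U ξ * Θ.Q ξ * Θ.yξ ξ - 2 * Θ.P ξ * Θ.Uξ ξ

section

variable {α : ℝ} {Θ₀ : LagState} {Θ : ℝ → LagState} {ξ : ℝ}

theorem SolvesAt.hasACDeriv_edens (h : SolvesAt α Θ ξ) {n : ℕ} {s t : ℝ} (hs : tau Θ n ξ = s)
    (hst : s ≤ t) (hte : (t : EReal) < tau Θ (n + 1) ξ) :
    HasACDeriv (fun t => (Θ t).edens ξ) (fun t => (Θ t).flux ξ) s t := by
  have hU := (h.eq_U n s hs).hasACDeriv hst hte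
  have hq := (h.eq_yξ n s hs).hasACDeriv hst hte
  have hk := (h.eq_hbar n s hs).hasACDeriv hst hte
  refine ((hU.pow_two.mul hq).add hk).congr_deriv fun x => ?_
  simp only [LagState.flux]; ring

/-- The energy density of a label grows at most by its flux. -/
theorem edens_le (hα0 : 0 ≤ α) (hα : α ≤ 1) (h : ξ ∈ regularLabels α Θ)
    (hτ : Tendsto (fun n => tau Θ n ξ) atTop (𝓝 ⊤)) {t : ℝ} (ht : 0 ≤ t)
    (hi : IntervalIntegrable (fun t => (Θ t).flux ξ) volume 0 t) :
    (Θ t).edens ξ ≤ (Θ 0).edens ξ + ∫ x in (0 : ℝ)..t, (Θ x).flux ξ := by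
  have hi' : ∀ {u v : ℝ}, 0 ≤ u → u ≤ v → v ≤ t →
      IntervalIntegrable (fun t => (Θ t).flux ξ) volume u v := fun hu huv hv =>
    hi.mono_set (by rw [uIcc_of_le huv, uIcc_of_le ht]; exact Icc_subset_Icc hu hv)
  have step : ∀ (n : ℕ) (s u : ℝ), 0 ≤ s → tau Θ n ξ = s → s ≤ u → u ≤ t →
      (u : EReal) < tau Θ (n + 1) ξ →
      (Θ s).edens ξ ≤ (Θ 0).edens ξ + ∫ x in (0 : ℝ)..s, (Θ x).flux ξ →
      (Θ u).edens ξ ≤ (Θ 0).edens ξ + ∫ x in (0 : ℝ)..u, (Θ x).flux ξ := by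
    intro n s u hs0 hs hsu hut hu hle
    have h1 := (h.1.hasACDeriv_edens hs hsu hu).integral_eq_sub
    have h2 := intervalIntegral.integral_add_adjacent_intervals (hi' le_rfl hs0 (hsu.trans hut))
      (hi' hs0 hsu hut)
    linarith
  have main : ∀ (n : ℕ) (s : ℝ), tau Θ n ξ = s → s ≤ t →
      (Θ s).edens ξ ≤ (Θ 0).edens ξ + ∫ x in (0 : ℝ)..s, (Θ x).flux ξ := by
    intro n
    induction n with
    | zero =>
      intro s hs _
      have : s = 0 := by
        rw [← EReal.coe_eq_coe_iff, ← hs]; rfl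
      subst this
      simp
    | succ n ih =>
      intro e he het
      obtain ⟨s, hs0, hs, hse, -, -⟩ := breakSeq_succ_eq_coe he
      obtain ⟨-, -, -, hjump⟩ := regular_at_tau hα h (n + 1) e he
      obtain ⟨-, -, -, l, hl, hl0, hle⟩ := hjump n.succ_ne_zero
      obtain ⟨-, hU, hq, -⟩ := h.1.jump_X n e he
      have hlim : Tendsto (fun t => (Θ t).edens ξ) (𝓝[<] e)
          (𝓝 ((Θ e).U ξ ^ 2 * (Θ e).yξ ξ + l)) := ((hU.pow 2).mul hq).add hl
      have hprim : Tendsto (fun u => (Θ 0).edens ξ + ∫ x in (0 : ℝ)..u, (Θ x).flux ξ) (𝓝[<] e)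
          (𝓝 ((Θ 0).edens ξ + ∫ x in (0 : ℝ)..e, (Θ x).flux ξ)) := by
        have hc := intervalIntegral.continuousOn_primitive_interval' hi (left_mem_uIcc)
        rw [uIcc_of_le ht] at hc
        refine Tendsto.const_add _
          ((hc e ⟨hs0.trans hse.le, het⟩).mono_left (nhdsWithin_le_iff.2 ?_))
        filter_upwards [Ioo_mem_nhdsLT hse] with x hx
          using ⟨hs0.trans hx.1.le, hx.2.le.trans het⟩
      -- The bound passes to the left limit, in which `h̄` tends to `l`; the actual value `(1 - α)
      -- l` is smaller by `α l ≥ 0`.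
      have h1 := le_of_tendsto_of_tendsto hlim hprim (by
        filter_upwards [Ioo_mem_nhdsLT hse] with x hx
        exact step n s x hs0 hs hx.1.le (hx.2.le.trans het) (lt_tau_succ he hx.2)
          (ih s hs (hse.le.trans het)))
      refine le_trans ?_ h1
      simp only [LagState.edens]
      nlinarith [mul_nonneg hα0 hl0]
  obtain ⟨n, s, hs, hst, hlt⟩ := exists_mem_interval hτ ht
  have hs0 : 0 ≤ s := by
    have := breakSeq_nonneg (fun t => (Θ t).yξ ξ) n
    change 0 ≤ tau Θ n ξ at this
    rw [hs] at this
    exact EReal.coe_nonneg.1 this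
  exact step n s t hs0 hs hst le_rfl hlt (main n s hs hst)

namespace IsGlobalSolution

theorem ae_regular (h : IsGlobalSolution α Θ₀ Θ) : ∀ᵐ ξ, ξ ∈ regularLabels α Θ := by
  filter_upwards [h.solves, (h.memG 0 le_rfl).nonneg, (h.memG 0 le_rfl).energy_rel]
    with ξ h1 h2 h3 using ⟨h1, h2.1, h2.2.2, h3⟩

/-- The measurability of the components in time and label. -/
theorem aesm_of_component (h : IsGlobalSolution α Θ₀ Θ) (hα : α ≤ 1)
    {f : LagState → ℝ → ℝ} {F : ℝ → ℝ → ℝ}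
    (hm : ∀ t, 0 ≤ t → AEStronglyMeasurable (f (Θ t)) volume)
    (hf : ∀ ξ, SolvesAt α Θ ξ → ∀ (n : ℕ) (s : ℝ), tau Θ n ξ = s →
      SolvesOn (fun t => f (Θ t) ξ) (F ξ) s (tau Θ (n + 1) ξ)) :
    AEStronglyMeasurable (fun p : ℝ × ℝ => f (Θ p.1) p.2)
      ((volume.restrict (Ici 0)).prod volume) := by
  refine aestronglyMeasurable_of_rightContinuous (F := fun t => f (Θ t)) hm ?_
  filter_upwards [h.ae_regular] with ξ hξ t ht
  obtain ⟨n, s, hs, hst, hlt⟩ := exists_mem_interval (h.tendsto_tau hα hξ) ht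
  exact (hf ξ hξ.1 n s hs).tendsto_right hst hlt

theorem aesm_y (h : IsGlobalSolution α Θ₀ Θ) (hα : α ≤ 1) :
    AEStronglyMeasurable (fun p : ℝ × ℝ => (Θ p.1).y p.2)
      ((volume.restrict (Ici 0)).prod volume) :=
  h.aesm_of_component hα (f := LagState.y) (F := fun ξ t => (Θ t).U ξ)
    (fun t ht => (h.memG t ht).aesm_y) fun _ hξ => hξ.eq_y

theorem aesm_U (h : IsGlobalSolution α Θ₀ Θ) (hα : α ≤ 1) :
    AEStronglyMeasurable (fun p : ℝ × ℝ => (Θ p.1).U p.2)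
      ((volume.restrict (Ici 0)).prod volume) :=
  h.aesm_of_component hα (f := LagState.U) (F := fun ξ t => -(Θ t).Q ξ)
    (fun t ht => (h.memG t ht).memE_U.1.1) fun _ hξ => hξ.eq_U

theorem aesm_yξ (h : IsGlobalSolution α Θ₀ Θ) (hα : α ≤ 1) :
    AEStronglyMeasurable (fun p : ℝ × ℝ => (Θ p.1).yξ p.2)
      ((volume.restrict (Ici 0)).prod volume) :=
  h.aesm_of_component hα (f := LagState.yξ) (F := fun ξ t => (Θ t).Uξ ξ)
    (fun t ht => (h.memG t ht).aesm_yξ) fun _ hξ => hξ.eq_yξ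

theorem aesm_Uξ (h : IsGlobalSolution α Θ₀ Θ) (hα : α ≤ 1) :
    AEStronglyMeasurable (fun p : ℝ × ℝ => (Θ p.1).Uξ p.2)
      ((volume.restrict (Ici 0)).prod volume) :=
  h.aesm_of_component hα (f := LagState.Uξ) (F := fun ξ t => 1 / 2 * (Θ t).hbar ξ + ((Θ t).U ξ ^ 2 - (Θ t).P ξ) * (Θ t).yξ ξ)
    (fun t ht => (h.memG t ht).memE_Uξ.1.1) fun _ hξ => hξ.eq_Uξ

theorem aesm_hbar (h : IsGlobalSolution α Θ₀ Θ) (hα : α ≤ 1) :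
    AEStronglyMeasurable (fun p : ℝ × ℝ => (Θ p.1).hbar p.2)
      ((volume.restrict (Ici 0)).prod volume) :=
  h.aesm_of_component hα (f := LagState.hbar) (F := fun ξ t => 2 * ((Θ t).U ξ ^ 2 - (Θ t).P ξ) * (Θ t).Uξ ξ)
    (fun t ht => (h.memG t ht).meas_hbar) fun _ hξ => hξ.eq_hbar

theorem aesm_source (h : IsGlobalSolution α Θ₀ Θ) (hα : α ≤ 1) :
    AEStronglyMeasurable (fun p : ℝ × ℝ => (Θ p.1).source p.2)
      ((volume.restrict (Ici 0)).prod volume) := by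
  have h1 := (h.aesm_U hα).pow 2
  have h2 := (h1.const_mul 2).mul (h.aesm_yξ hα)
  exact h2.add (h.aesm_hbar hα)

theorem aesm_P (h : IsGlobalSolution α Θ₀ Θ) (hα : α ≤ 1) :
    AEStronglyMeasurable (fun p : ℝ × ℝ => (Θ p.1).P p.2)
      ((volume.restrict (Ici 0)).prod volume) := by
  have := (aesm_nonlocal (c := fun _ => 1) (y := fun t => (Θ t).y) (s := fun t => (Θ t).source)
    measurable_const (h.aesm_y hα) (h.aesm_source hα)).const_mul (1 / 4)
  simp only [one_mul] at this
  exact this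

theorem aesm_Q (h : IsGlobalSolution α Θ₀ Θ) (hα : α ≤ 1) :
    AEStronglyMeasurable (fun p : ℝ × ℝ => (Θ p.1).Q p.2)
      ((volume.restrict (Ici 0)).prod volume) := by
  exact (aesm_nonlocal (c := fun p => Real.sign (p.1 - p.2)) (y := fun t => (Θ t).y)
    (s := fun t => (Θ t).source) (measurable_sign.comp (measurable_fst.sub measurable_snd))
    (h.aesm_y hα) (h.aesm_source hα)).const_mul (-(1 / 4))

theorem aesm_flux (h : IsGlobalSolution α Θ₀ Θ) (hα : α ≤ 1) :
    AEStronglyMeasurable (fun p : ℝ × ℝ => (Θ p.1).flux p.2)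
      ((volume.restrict (Ici 0)).prod volume) := by
  have h1 := (h.aesm_U hα).pow 2
  have h2 := (h1.const_mul 3).mul (h.aesm_Uξ hα)
  have h3 := (((h.aesm_U hα).const_mul 2).mul (h.aesm_Q hα)).mul (h.aesm_yξ hα)
  have h4 := ((h.aesm_P hα).const_mul 2).mul (h.aesm_Uξ hα)
  exact (h2.sub h3).sub h4

end IsGlobalSolution

/-! ### The flux as a label derivative, and monotonicity of the energy. -/

theorem MemG.ae_abs_flux_le {Θ : LagState} (h : MemG α Θ) {B N : ℝ} (hN : 0 ≤ N)
    (hB : Θ.energy ≤ B) (hX : Θ.normX ≤ ENNReal.ofReal N) :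
    ∀ᵐ ξ, |Θ.flux ξ| ≤ 3 * B * N + 2 * (1 + B) * B * (1 + N) + 2 * B * N := by
  have hB0 := h.energy_nonneg.trans hB
  filter_upwards [h.ae_abs_yξ_sub_one_le hN hX, h.ae_abs_Uξ_le hN hX] with ξ h1 h2
  have hU2 := (h.U_sq_le ξ).trans hB
  have hU : |Θ.U ξ| ≤ 1 + B := by
    refine abs_le_of_sq_le_sq (hU2.trans ?_) (by linarith); nlinarith
  have hP := (h.abs_P_le ξ).trans hB
  have hQ := (h.abs_Q_le ξ).trans hB
  have hq : |Θ.yξ ξ| ≤ 1 + N := by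
    have := abs_le.1 h1
    rw [abs_le]; constructor <;> linarith
  have t1 : |3 * Θ.U ξ ^ 2 * Θ.Uξ ξ| ≤ 3 * B * N := by
    rw [abs_mul, abs_of_nonneg (by positivity : (0 : ℝ) ≤ 3 * Θ.U ξ ^ 2)]
    exact mul_le_mul (by linarith) h2 (abs_nonneg _) (by positivity)
  have t2 : |2 * Θ.U ξ * Θ.Q ξ * Θ.yξ ξ| ≤ 2 * (1 + B) * B * (1 + N) := by
    rw [abs_mul, abs_mul, abs_mul, abs_two]
    gcongr
  have t3 : |2 * Θ.P ξ * Θ.Uξ ξ| ≤ 2 * B * N := by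
    rw [abs_mul, abs_mul, abs_two]
    gcongr
  exact (abs_sub _ _).trans (add_le_add ((abs_sub _ _).trans (add_le_add t1 t2)) t3)

/-- Supplies the dominating constant when the boundary terms are sent to infinity under the time
integral. -/
theorem MemG.abs_boundary_le {Θ : LagState} (h : MemG α Θ) {B : ℝ} (hB : Θ.energy ≤ B) (ξ : ℝ) :
    |Θ.U ξ ^ 3 - 2 * Θ.P ξ * Θ.U ξ| ≤ 3 * B * (1 + B) := by
  have hB0 := h.energy_nonneg.trans hB
  have hU2 := (h.U_sq_le ξ).trans hB
  have hU : |Θ.U ξ| ≤ 1 + B := by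
    refine abs_le_of_sq_le_sq (hU2.trans ?_) (by linarith); nlinarith
  have hP := (h.abs_P_le ξ).trans hB
  have e : Θ.U ξ ^ 3 - 2 * Θ.P ξ * Θ.U ξ = (Θ.U ξ ^ 2 - 2 * Θ.P ξ) * Θ.U ξ := by ring
  rw [e, abs_mul]
  refine mul_le_mul ?_ hU (abs_nonneg _) (by positivity)
  have := abs_le.1 hP
  rw [abs_le]
  constructor <;> nlinarith [sq_nonneg (Θ.U ξ)]

theorem MemG.tendsto_boundary {Θ : LagState} (h : MemG α Θ) {l : Filter ℕ} {x : ℕ → ℝ}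
    (hx : Tendsto (fun n => Θ.U (x n)) l (𝓝 0)) :
    Tendsto (fun n => Θ.U (x n) ^ 3 - 2 * Θ.P (x n) * Θ.U (x n)) l (𝓝 0) := by
  have h1 : Tendsto (fun n => 2 * Θ.P (x n) * Θ.U (x n)) l (𝓝 0) := by
    refine squeeze_zero_norm (a := fun n => 2 * Θ.energy * |Θ.U (x n)|) (fun n => ?_) ?_
    · rw [Real.norm_eq_abs, abs_mul, abs_mul, abs_two]
      have := h.abs_P_le (x n)
      gcongr
    · simpa using hx.abs.const_mul (2 * Θ.energy)
  simpa using (hx.pow 3).sub h1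

end

/-- The flux is the derivative of `U³ - 2 P U` in the label. -/
theorem MemG.hasACDeriv_flux {α : ℝ} {Θ : LagState} (h : MemG α Θ) {a b : ℝ} (hab : a ≤ b) :
    HasACDeriv (fun ξ => Θ.U ξ ^ 3 - 2 * Θ.P ξ * Θ.U ξ) Θ.flux a b := by
  have hU := h.hasACDeriv_U hab
  have H := (hU.mul hU.pow_two).sub (((h.hasACDeriv_P hab).mul hU).const_mul 2)
  have e : (fun ξ => Θ.U ξ ^ 3 - 2 * Θ.P ξ * Θ.U ξ) =
      fun ξ => Θ.U ξ * Θ.U ξ ^ 2 - 2 * (Θ.P ξ * Θ.U ξ) := by ext; ring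
  rw [e]
  exact H.congr_deriv fun x => by simp only [LagState.flux]; ring

namespace IsGlobalSolution

variable {α : ℝ} {Θ₀ : LagState} {Θ : ℝ → LagState}

/-- The flux has a bound uniform on `[0, t]`, but with an exceptional null set of labels depending
on time; integrability on the product is therefore read off from iterated integrals. -/
theorem integrable_flux (h : IsGlobalSolution α Θ₀ Θ) (hα : α ≤ 1) {t : ℝ} (ht : 0 ≤ t)
    {a b : ℝ} (hab : a ≤ b) : Integrable (Function.uncurry fun s ξ => (Θ s).flux ξ)
      ((volume.restrict (uIoc 0 t)).prod (volume.restrict (Ioc a b))) := by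
  obtain ⟨N, hN, hX⟩ := h.exists_normX_le t
  obtain ⟨B, hB0, hB⟩ := h.exists_energy_le t
  have hm : AEStronglyMeasurable (Function.uncurry fun s ξ => (Θ s).flux ξ)
      ((volume.restrict (uIoc 0 t)).prod (volume.restrict (Ioc a b))) := by
    refine (h.aesm_flux hα).mono_ac (Measure.AbsolutelyContinuous.prod ?_ ?_)
    · refine (Measure.restrict_mono ?_ le_rfl).absolutelyContinuous
      rw [uIoc_of_le ht]
      exact fun x hx => hx.1.le
    · exact Measure.restrict_le_self.absolutelyContinuous
  have hI : ∀ s ∈ uIoc 0 t, Integrable (fun ξ => (Θ s).flux ξ) (volume.restrict (Ioc a b)) ∧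
      ∫ ξ in Ioc a b, ‖(Θ s).flux ξ‖ ≤
        (3 * B * N + 2 * (1 + B) * B * (1 + N) + 2 * B * N) * (b - a) := by
    intro s hs
    rw [uIoc_of_le ht] at hs
    have hs' : s ∈ Icc 0 t := ⟨hs.1.le, hs.2⟩
    have hG := h.memG s hs'.1
    have hbd := hG.ae_abs_flux_le hN (hB s hs') (hX s hs')
    have hms : AEStronglyMeasurable (Θ s).flux (volume.restrict (Ioc a b)) :=
      (hG.hasACDeriv_flux hab).intervalIntegrable.1.aestronglyMeasurable
    refine ⟨.of_bound hms _ (ae_restrict_of_ae hbd), ?_⟩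
    have h1 := norm_setIntegral_le_of_norm_le_const_ae' (μ := volume) (s := Ioc a b)
      (f := fun ξ => ‖(Θ s).flux ξ‖) measure_Ioc_lt_top (by
        filter_upwards [hbd] with ξ hξ _
        rwa [norm_norm])
    rw [Real.norm_eq_abs, Real.volume_real_Ioc_of_le hab] at h1
    exact (le_abs_self _).trans h1
  have : IsFiniteMeasure (volume.restrict (uIoc 0 t)) :=
    ⟨by rw [uIoc_of_le ht, Measure.restrict_apply_univ]; exact measure_Ioc_lt_top⟩
  rw [integrable_prod_iff hm]
  refine ⟨?_, ?_⟩
  · filter_upwards [ae_restrict_mem measurableSet_uIoc] with s hs using (hI s hs).1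
  · refine Integrable.of_bound hm.norm.integral_prod_right'
      ((3 * B * N + 2 * (1 + B) * B * (1 + N) + 2 * B * N) * (b - a)) ?_
    filter_upwards [ae_restrict_mem measurableSet_uIoc] with s hs
    rw [Real.norm_eq_abs, abs_of_nonneg (integral_nonneg fun _ => norm_nonneg _)]
    exact (hI s hs).2

/-- The energy does not increase. -/
theorem energy_le_initial (h : IsGlobalSolution α Θ₀ Θ) (hα0 : 0 ≤ α) (hα : α ≤ 1) {t : ℝ}
    (ht : 0 ≤ t) : (Θ t).energy ≤ (Θ 0).energy := by
  obtain ⟨B, hB0, hB⟩ := h.exists_energy_le t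
  have hGt := h.memG t ht
  have hG0 := h.memG 0 le_rfl
  let φ : ℕ → ℝ → ℝ := fun n s => ((Θ s).U n ^ 3 - 2 * (Θ s).P n * (Θ s).U n) -
    ((Θ s).U (-n) ^ 3 - 2 * (Θ s).P (-n) * (Θ s).U (-n))
  have hn : ∀ n : ℕ, (-n : ℝ) ≤ n := fun n => by
    have := Nat.cast_nonneg (α := ℝ) n
    linarith
  have hφ : ∀ (n : ℕ) (s : ℝ), s ∈ uIoc 0 t →
      ∫ ξ in Ioc (-n : ℝ) n, (Θ s).flux ξ = φ n s := by
    intro n s hs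
    rw [uIoc_of_le ht] at hs
    rw [← intervalIntegral.integral_of_le (hn n)]
    exact ((h.memG s hs.1.le).hasACDeriv_flux (hn n)).integral_eq_sub
  -- The balance is integrated over the labels in `(-n, n]`, a bounded range on which Fubini
  -- applies; exchanging the integrals turns the flux into the boundary terms `φ n`.
  have loc : ∀ n : ℕ, ∫ ξ in (-n : ℝ)..n, (Θ t).edens ξ ≤
      (∫ ξ in (-n : ℝ)..n, (Θ 0).edens ξ) + ∫ s in (0 : ℝ)..t, φ n s := by
    intro n
    have hF := h.integrable_flux hα ht (hn n)
    have h1 : ∫ s in (0 : ℝ)..t, φ n s =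
        ∫ ξ in Ioc (-n : ℝ) n, ∫ s in (0 : ℝ)..t, (Θ s).flux ξ := by
      rw [← intervalIntegral_integral_swap hF]
      refine intervalIntegral.integral_congr_ae (ae_of_all _ fun s hs => (hφ n s hs).symm)
    have h2 : Integrable (fun ξ => ∫ s in (0 : ℝ)..t, (Θ s).flux ξ)
        (volume.restrict (Ioc (-n : ℝ) n)) := by
      have := hF.integral_prod_right
      simpa only [Function.uncurry, intervalIntegral.integral_of_le ht, uIoc_of_le ht] using this
    rw [intervalIntegral.integral_of_le (hn n), intervalIntegral.integral_of_le (hn n), h1,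
      ← integral_add hG0.integrable_edens.integrableOn h2]
    refine integral_mono_ae hGt.integrable_edens.integrableOn
      (hG0.integrable_edens.integrableOn.add h2) ?_
    filter_upwards [ae_restrict_of_ae h.ae_regular, hF.prod_left_ae] with ξ hξ hi
    exact edens_le hα0 hα hξ (h.tendsto_tau hα hξ) ht (intervalIntegrable_iff.2 hi)
  have hbot : Tendsto (fun n : ℕ => (-n : ℝ)) atTop atBot :=
    tendsto_neg_atTop_atBot.comp tendsto_natCast_atTop_atTop
  -- The boundary terms are bounded on `[0, t]` and vanish at each time because `U → 0` at both ends
  -- while `P` is bounded.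
  have hlim : Tendsto (fun n : ℕ => ∫ s in (0 : ℝ)..t, φ n s) atTop (𝓝 0) := by
    suffices H : Tendsto (fun n : ℕ => ∫ s in (0 : ℝ)..t, φ n s) atTop
        (𝓝 (∫ s in (0 : ℝ)..t, (0 : ℝ))) by
      simpa only [intervalIntegral.integral_zero] using H
    refine intervalIntegral.tendsto_integral_filter_of_dominated_convergence
      (fun _ => 3 * B * (1 + B) + 3 * B * (1 + B)) (Eventually.of_forall fun n => ?_)
      (Eventually.of_forall fun n => ae_of_all _ fun s hs => ?_) intervalIntegrable_const
      (ae_of_all _ fun s hs => ?_) (μ := volume) (l := atTop) (F := φ) (f := fun _ => 0)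
    · refine (h.integrable_flux hα ht (hn n)).aestronglyMeasurable.integral_prod_right'.congr ?_
      filter_upwards [ae_restrict_mem measurableSet_uIoc] with s hs using hφ n s hs
    · rw [uIoc_of_le ht] at hs
      have hG := h.memG s hs.1.le
      have hE := hB s ⟨hs.1.le, hs.2⟩
      exact (abs_sub _ _).trans
        (add_le_add (hG.abs_boundary_le hE _) (hG.abs_boundary_le hE _))
    · rw [uIoc_of_le ht] at hs
      have hG := h.memG s hs.1.le
      simpa using (hG.tendsto_boundary (hG.tendsto_U_atTop.comp tendsto_natCast_atTop_atTop)).sub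
        (hG.tendsto_boundary (hG.tendsto_U_atBot.comp hbot))
  have l1 := intervalIntegral_tendsto_integral hGt.integrable_edens hbot
    (tendsto_natCast_atTop_atTop (R := ℝ))
  have l0 := intervalIntegral_tendsto_integral hG0.integrable_edens hbot
    (tendsto_natCast_atTop_atTop (R := ℝ))
  have := le_of_tendsto_of_tendsto' l1 (l0.add hlim) loc
  rwa [add_zero] at this

end IsGlobalSolution

end TwoCH

end

/-! ### The uniform waiting time. -/

/-- Breaking times of `α`-dissipative solutions do not accumulate. The waiting time `T̂`, called
`T` here, depends only on `M`. -/
theorem corollary2p14 (M : ℝ) :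
    ∃ T : ℝ, 0 < T ∧
      ∀ (α : ℝ), 0 ≤ α → α ≤ 1 →
      ∀ (Θ₀ : TwoCH.LagState), TwoCH.MemG α Θ₀ → TwoCH.MemB M Θ₀ →
      ∀ (Θ : ℝ → TwoCH.LagState), TwoCH.IsGlobalSolution α Θ₀ Θ →
        (∀ᵐ ξ : ℝ, ξ ∈ TwoCH.regularLabels α Θ) ∧
        ∀ ξ ∈ TwoCH.regularLabels α Θ,
          -- the breaking times do not accumulate
          Tendsto (fun j : ℕ => TwoCH.tau Θ j ξ) atTop (𝓝 ⊤) ∧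
          -- at most one breaking in every time interval of length `T`
          (∀ T₀ : ℝ, 0 ≤ T₀ → ∀ j k : ℕ, 1 ≤ j → 1 ≤ k →
            TwoCH.tau Θ j ξ ∈ Icc (T₀ : EReal) ((T₀ + T : ℝ) : EReal) →
            TwoCH.tau Θ k ξ ∈ Icc (T₀ : EReal) ((T₀ + T : ℝ) : EReal) → j = k) ∧
          -- successive breaking times are more than `T` apart
          (∀ j : ℕ, 1 ≤ j → TwoCH.tau Θ j ξ < ⊤ →
            TwoCH.tau Θ j ξ + (T : EReal) < TwoCH.tau Θ (j + 1) ξ) ∧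
          -- `U_ξ` is nonnegative for a time `T` after each breaking
          (∀ (j : ℕ) (s : ℝ), 1 ≤ j → TwoCH.tau Θ j ξ = (s : EReal) →
            ∀ t ∈ Icc s (s + T), 0 ≤ (Θ t).Uξ ξ) := by
  have hN : 0 ≤ max M 0 := le_max_right _ _
  -- Twice the energy bound for a state of norm at most `max M 0`; the maximum makes the radius
  -- nonnegative whatever the sign of `M`.
  obtain ⟨C, hCdef⟩ : ∃ C, C = 2 * (5 * max M 0 ^ 2 + 5 * max M 0 ^ 3) := ⟨_, rfl⟩
  have hC : 0 ≤ C := by rw [hCdef]; positivity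
  have hpos : 0 < 8 * (2 * C + 1) := by linarith
  obtain ⟨T, hT, hTC⟩ : ∃ T : ℝ, 0 < T ∧ 8 * (2 * C + 1) * T ≤ 1 :=
    ⟨(8 * (2 * C + 1))⁻¹, inv_pos.2 hpos, (mul_inv_cancel₀ hpos.ne').le⟩
  refine ⟨T, hT, fun α hα0 hα Θ₀ _ hM Θ h => ⟨h.ae_regular, fun ξ hξ => ?_⟩⟩
  have hE : ∀ t, 0 ≤ t → 2 * (Θ t).energy ≤ C := by
    intro t ht
    have h1 : Θ₀.normX ≤ ENNReal.ofReal (max M 0) :=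
      (le_self_add.trans le_self_add).trans
        (le_trans hM (ENNReal.ofReal_le_ofReal (le_max_left _ _)))
    rw [← h.initial] at h1
    have h2 := (h.memG 0 le_rfl).energy_le hN h1
    linarith [h.energy_le_initial hα0 hα ht]
  have wait : ∀ (j : ℕ) (s : ℝ), 1 ≤ j → TwoCH.tau Θ j ξ = (s : EReal) →
      ((s + T : ℝ) : EReal) < TwoCH.tau Θ (j + 1) ξ ∧ ∀ t ∈ Icc s (s + T), 0 ≤ (Θ t).Uξ ξ := by
    intro j s hj hs
    refine TwoCH.waiting_time hα hξ (by omega) hs hC (by simpa using hTC) fun t ht => ?_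
    have hs0 : 0 ≤ s := by
      have h1 : 0 ≤ TwoCH.tau Θ j ξ := TwoCH.breakSeq_nonneg _ _
      rw [hs] at h1
      exact EReal.coe_nonneg.1 h1
    exact ((h.memG t (hs0.trans ht.1)).abs_sq_sub_P_le ξ).trans (hE t (hs0.trans ht.1))
  have gap : ∀ j : ℕ, 1 ≤ j → TwoCH.tau Θ j ξ < ⊤ →
      TwoCH.tau Θ j ξ + (T : EReal) < TwoCH.tau Θ (j + 1) ξ := by
    intro j hj hlt
    obtain ⟨s, -, hs⟩ := TwoCH.exists_real_of_breakSeq_lt_top hlt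
    change TwoCH.tau Θ j ξ = s at hs
    have h1 := (wait j s hj hs).1
    rwa [EReal.coe_add, ← hs] at h1
  have sep : ∀ T₀ : ℝ, ∀ j k : ℕ, 1 ≤ j → j < k →
      (T₀ : EReal) ≤ TwoCH.tau Θ j ξ → TwoCH.tau Θ k ξ ≤ ((T₀ + T : ℝ) : EReal) → False := by
    intro T₀ j k hj hjk h1 h2
    have hmono : Monotone fun n => TwoCH.tau Θ n ξ := TwoCH.breakSeq_monotone _
    have h3 := gap j hj (((hmono hjk.le).trans h2).trans_lt (EReal.coe_lt_top _))
    -- The strict gap gives `T₀ + T ≤ τ_j + T < τ_{j+1} ≤ τ_k ≤ T₀ + T`, so even a closed interval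
    -- of length `T` cannot contain both times.
    have h4 : ((T₀ + T : ℝ) : EReal) ≤ TwoCH.tau Θ j ξ + (T : EReal) := by
      rw [EReal.coe_add]; exact add_le_add_left h1 _
    exact absurd ((h4.trans_lt h3).trans_le ((hmono (Nat.succ_le_of_lt hjk)).trans h2))
      (lt_irrefl _)
  refine ⟨h.tendsto_tau hα hξ, fun T₀ _ j k hj hk hmj hmk => ?_, gap,
    fun j s hj hs => (wait j s hj hs).2⟩
  rcases lt_trichotomy j k with hlt | heq | hgt
  · exact (sep T₀ j k hj hlt hmj.1 hmk.2).elim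
  · exact heq
  · exact (sep T₀ k j hk hgt hmk.1 hmj.2).elim
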